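/- **Problem.** Let $n,m,p\ge 0$ be integers and consider $$\min_x\ f(x)+q(x)\quad\text{s.t.}\quad g(x)\le 0,\ h(x)=0,\ x\in K, \tag{P}$$ where $K\subseteq\mathbb R^n$ is nonempty, closed and convex; $f:\mathbb R^n\to\mathbb R$, $g:\mathbb R^n\to\mathbb R^m$, $h:\mathbb R^n\to\mathbb R^p$ are continuously differentiable with locally Lipschitz gradients on an open set containing $K$; and $q:\mathbb R^n\to\mathbb R$ is convex on $K$ and locally Lipschitz on an open set containing $K$. Fix any convex set $D\supseteq K$ on which $q$ is convex (for instance $D=K$, or $D=\mathbb R^n$ if $q$ is convex everywhere), and let $\partial q(x)=\{v: q(y)\ge q(x)+v^T(y-x)\ \forall y\in D\}$. For a convex set $C$ let $N_C(x)=\{v: v^T(y-x)\le 0\ \forall y\in C\}$ if $x\in C$ and $N_C(x)=\emptyset$ otherwise. Let $\mathbb B_\infty$ be the closed unit ball of the infinity norm, $e$ the all-ones vector, $\alpha_+=\max\{0,\alpha\}$, $\nabla g,\nabla h$ the transposed Jacobians, and $\varphi(x)=\max_{i,j}\{g_i(x)_+,|h_j(x)|\}$ (equal to $0$ if $m=p=0$).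 **Stationarity.** Let $$M_1(x)=\{(\xi,\pi): \xi\in N_{\mathbb R^m_-}(g(x)),\ \pi\in N_{\{0\}}(h(x)),\ 0\in\nabla f(x)+\partial q(x)+\nabla g(x)\xi+\nabla h(x)\pi+N_K(x)\},$$ $$M_0(x)=\{(\xi,\pi): \xi\in N_{\mathbb R^m_-}(g(x)-\varphi(x)e),\ \pi\in N_{\varphi(x)\mathbb B_\infty}(h(x)),\ 0\in\nabla g(x)\xi+\nabla h(x)\pi+N_K(x)\}.$$ A point $x\in K$ is a *KKT* solution if $g(x)\le0$, $h(x)=0$ and $M_1(x)\neq\emptyset$; a *Fritz-John* solution if $g(x)\le0$, $h(x)=0$ and $M_0(x)\ne\{0\}$; an *external stationary* solution if $g_i(x)>0$ for some $i$ or $h_j(x)\neq0$ for some $j$, and $M_0(x)\neq\{0\}$. It is *generalized stationary* if it is one of these. The extended Mangasarian-Fromovitz constraint qualification (*eMFCQ*) holds at $x\in K$ if $M_0(x)=\{0\}$. **Direction.** Let $0<\rho<\beta$, $\lambda\in(0,1)$, let $\tilde f(d;x)$ and $\tilde g_i(d;x)$ be surrogates, $\tilde h(d;x)=h(x)+\nabla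 h(x)^Td$, and $$\kappa(x)=(1-\lambda)\varphi(x)+\lambda\min_d\Big\{\max_{i,j}\{\tilde g_i(d;x)_+,|\tilde h_j(d;x)|\}:\ \|d\|_\infty\le\rho,\ x+d\in K\Big\}.$$ For $x\in K$, $d(x)$ is the solution of $$\min_d\ \tilde f(d;x)+q(x+d)\quad\text{s.t.}\quad \tilde g(d;x)\le\kappa(x)e,\ -\kappa(x)e\le\tilde h(d;x)\le\kappa(x)e,\ \|d\|_\infty\le\beta,\ x+d\in K. \tag{P$_x$}$$ **Assumption A.** There are open sets $O_d\supseteq\beta\mathbb B_\infty$ and $O_x\supseteq K$ such that $\tilde f(\cdot;x)$ and each $\tilde g_i(\cdot;x)$ are continuously differentiable on $O_d$ for every $x\in O_x$, and: $\tilde f(\cdot;x)$ is strongly convex on $O_d$ for every $x\in K$ with a modulus $c>0$ independent of $x$; $\tilde f$ and $\nabla_1\tilde f$ are continuous on $O_d\times O_x$; $\nabla_1\tilde f(0;x)=\nabla f(x)$ for $x\in K$; each $\tilde g_i(\cdot;x)$ is convex on $O_d$ for $x\in K$; each $\tilde g_i$ is continuous on $\mathbb R^n\times O_x$ and each $\nabla_1\tilde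 g_i$ is continuous on $O_d\times O_x$; $\tilde g_i(0;x)=g_i(x)$ and $\nabla_1\tilde g_i(0;x)=\nabla g_i(x)$ for $x\in K$. Here $\nabla_1$ denotes the gradient with respect to $d$. **Assumption B.** For every compact $S\subseteq K$ there are $\mu,\alpha>0$ with $\|d(y)-d(z)\|\le\mu\|y-z\|^\alpha$ for all $y,z\in S$. **Algorithm.** Let $\gamma^\nu\in(0,1]$, $\gamma^\nu\to0$, $\sum_\nu\gamma^\nu=\infty$, and $x^0\in K$. If $x^\nu$ is generalized stationary, stop and return $x^\nu$; otherwise set $x^{\nu+1}=x^\nu+\gamma^\nu d(x^\nu)$. If the algorithm stops, the returned point is repeated forever, so that $\{x^\nu\}$ is always an infinite sequence. **Theorem 1.** Let $\{x^\nu\}$ be generated by the algorithm, with $\tilde f$ and $\tilde g$ satisfying Assumption A. Then $x^\nu\in K$ for all $\nu$, and either $\{x^\nu\}$ is unbounded or both of the following hold: (i) at least one limit point $\hat x$ of $\{x^\nu\}$ is generalized stationary for (P), and if the eMFCQ holds at this $\hat x$, then $\hat x$ is a KKT solution; (ii) if the eMFCQ holds at every limit point of $\{x^\nu\}$ and Assumption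 B holds, then every limit point of $\{x^\nu\}$ is a KKT solution. -/

import Mathlib

open Filter Topology
open scoped RealInnerProductSpace

noncomputable section

namespace DSM

/-- Euclidean space `ℝᵏ`. -/
abbrev Vec (k : ℕ) : Type := EuclideanSpace ℝ (Fin k)

/-- The normal cone to the convex set `C` at `x` (empty when `x ∉ C`). -/
def normalCone {k : ℕ} (C : Set (Vec k)) (x : Vec k) : Set (Vec k) :=
  {v | x ∈ C ∧ ∀ y ∈ C, ⟪v, y - x⟫ ≤ 0}

/-- The subdifferential at `x` of a function `q` that is convex on the set `D`. -/
def subdiff {k : ℕ} (D : Set (Vec k)) (q : Vec k → ℝ) (x : Vec k) : Set (Vec k) :=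
  {v | ∀ y ∈ D, q x + ⟪v, y - x⟫ ≤ q y}

/-- The nonpositive orthant of `ℝᵏ`. -/
def nonposOrthant (k : ℕ) : Set (Vec k) := {u | ∀ i, u i ≤ 0}

/-- The closed ball of radius `r` about the origin for the infinity-norm. -/
def boxBall (k : ℕ) (r : ℝ) : Set (Vec k) := {u | ∀ i, |u i| ≤ r}

/-- `max_{i,j} {(u_i)₊, |v_j|}`; it is `0` when there are no indices at all. -/
def maxViolation {m p : ℕ} (u : Fin m → ℝ) (v : Fin p → ℝ) : ℝ :=
  max (⨆ i, max (u i) 0) (⨆ j, |v j|)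

/-- `φ` is continuously differentiable with locally Lipschitz gradient on an open set
containing `K`. -/
def IsC11Near {k : ℕ} (K : Set (Vec k)) (φ : Vec k → ℝ) : Prop :=
  ∃ U : Set (Vec k), IsOpen U ∧ K ⊆ U ∧ ContDiffOn ℝ 1 φ U ∧ LocallyLipschitzOn U (gradient φ)

/-- The data of the problem: minimize `f + q` subject to `g ≤ 0`, `h = 0`, `x ∈ K`.
The set `D` is a convex set containing `K` on which `q` is convex: it may be `K` itself, or the
whole space when `q` is convex everywhere. The subdifferential of `q` is taken as that of a
convex function on `D`. -/
structure Problem (n m p : ℕ) where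
  K : Set (Vec n)
  f : Vec n → ℝ
  q : Vec n → ℝ
  D : Set (Vec n)
  g : Fin m → Vec n → ℝ
  h : Fin p → Vec n → ℝ

namespace Problem

variable {n m p : ℕ}

/-- The standing assumptions on the problem. -/
structure Standing (P : Problem n m p) : Prop where
  K_nonempty : P.K.Nonempty
  K_closed : IsClosed P.K
  K_convex : Convex ℝ P.K
  f_smooth : IsC11Near P.K P.f
  g_smooth : ∀ i, IsC11Near P.K (P.g i)
  h_smooth : ∀ j, IsC11Near P.K (P.h j)
  K_sub_D : P.K ⊆ P.D
  q_convex : ConvexOn ℝ P.D P.q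
  q_lipschitz : ∃ U : Set (Vec n), IsOpen U ∧ P.K ⊆ U ∧ LocallyLipschitzOn U P.q

/-- The measure of infeasibility `φ(x) = max_{i,j} {g_i(x)₊, |h_j(x)|}`. -/
def infeas (P : Problem n m p) (x : Vec n) : ℝ :=
  maxViolation (fun i => P.g i x) (fun j => P.h j x)

/-- `∇g(x) ξ + ∇h(x) π`. -/
def multSum (P : Problem n m p) (x : Vec n) (ξ : Vec m) (π : Vec p) : Vec n :=
  ∑ i, ξ i • gradient (P.g i) x + ∑ j, π j • gradient (P.h j) x

/-- The set of KKT multipliers at `x`. -/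
def M1 (P : Problem n m p) (x : Vec n) : Set (Vec m × Vec p) :=
  {μ | μ.1 ∈ normalCone (nonposOrthant m) (WithLp.toLp 2 fun i => P.g i x) ∧
    μ.2 ∈ normalCone {0} (WithLp.toLp 2 fun j => P.h j x) ∧
    ∃ v ∈ subdiff P.D P.q x, ∃ ζ ∈ normalCone P.K x,
      gradient P.f x + v + P.multSum x μ.1 μ.2 + ζ = 0}

/-- The set of abnormal multipliers at `x`. -/
def M0 (P : Problem n m p) (x : Vec n) : Set (Vec m × Vec p) :=
  {μ | μ.1 ∈ normalCone (nonposOrthant m) (WithLp.toLp 2 fun i => P.g i x - P.infeas x) ∧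
    μ.2 ∈ normalCone (boxBall p (P.infeas x)) (WithLp.toLp 2 fun j => P.h j x) ∧
    ∃ ζ ∈ normalCone P.K x, P.multSum x μ.1 μ.2 + ζ = 0}

/-- `x` satisfies the functional constraints. -/
def SatisfiesConstraints (P : Problem n m p) (x : Vec n) : Prop :=
  (∀ i, P.g i x ≤ 0) ∧ ∀ j, P.h j x = 0

/-- KKT solution. -/
def IsKKT (P : Problem n m p) (x : Vec n) : Prop :=
  x ∈ P.K ∧ P.SatisfiesConstraints x ∧ (P.M1 x).Nonempty

/-- Fritz-John solution. -/
def IsFJ (P : Problem n m p) (x : Vec n) : Prop :=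
  x ∈ P.K ∧ P.SatisfiesConstraints x ∧ P.M0 x ≠ {0}

/-- External stationary solution. -/
def IsES (P : Problem n m p) (x : Vec n) : Prop :=
  x ∈ P.K ∧ ((∃ i, 0 < P.g i x) ∨ ∃ j, P.h j x ≠ 0) ∧ P.M0 x ≠ {0}

/-- Generalized stationary solution. -/
def IsGenStationary (P : Problem n m p) (x : Vec n) : Prop :=
  P.IsKKT x ∨ P.IsFJ x ∨ P.IsES x

/-- The extended Mangasarian-Fromovitz constraint qualification. -/
def EMFCQ (P : Problem n m p) (x : Vec n) : Prop :=
  x ∈ P.K ∧ P.M0 x = {0}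

end Problem

/-- The data of the method: the surrogates `f̃(d; x)` (written `ft d x`) and `g̃_i(d; x)`
(written `gt i d x`), the radii `β` and `ρ`, and the weight `lam`. -/
structure Method (n m : ℕ) where
  ft : Vec n → Vec n → ℝ
  gt : Fin m → Vec n → Vec n → ℝ
  β : ℝ
  ρ : ℝ
  lam : ℝ

namespace Method

variable {n m p : ℕ}

/-- The admissible parameters: `β > 0`, `ρ ∈ (0, β)`, `lam ∈ (0, 1)`. -/
structure Admissible (A : Method n m) : Prop where
  β_pos : 0 < A.β
  ρ_pos : 0 < A.ρ
  ρ_lt : A.ρ < A.β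
  lam_pos : 0 < A.lam
  lam_lt : A.lam < 1

/-- The linearization `h̃_j(d; x) = h_j(x) + ∇h_j(x)ᵀ d`. -/
def ht (P : Problem n m p) (j : Fin p) (d x : Vec n) : ℝ :=
  P.h j x + ⟪gradient (P.h j) x, d⟫

/-- The relaxation `κ(x)`; the infimum below is over the `d ∈ K - x` with `‖d‖_∞ ≤ ρ`. -/
def kappa (A : Method n m) (P : Problem n m p) (x : Vec n) : ℝ :=
  (1 - A.lam) * P.infeas x +
    A.lam * sInf ((fun d => maxViolation (fun i => A.gt i d x) (fun j => ht P j d x)) ''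
      {d | d ∈ boxBall n A.ρ ∧ x + d ∈ P.K})

/-- The feasible set of the subproblem at `x`. -/
def feasible (A : Method n m) (P : Problem n m p) (x : Vec n) : Set (Vec n) :=
  {d | (∀ i, A.gt i d x ≤ A.kappa P x) ∧
    (∀ j, -A.kappa P x ≤ ht P j d x ∧ ht P j d x ≤ A.kappa P x) ∧
    d ∈ boxBall n A.β ∧ x + d ∈ P.K}

/-- `d` solves the subproblem at `x`: minimize `f̃(d; x) + q(x + d)` over the feasible set. -/
def Solves (A : Method n m) (P : Problem n m p) (x d : Vec n) : Prop :=
  d ∈ A.feasible P x ∧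
    ∀ e ∈ A.feasible P x, A.ft d x + P.q (x + d) ≤ A.ft e x + P.q (x + e)

/-- The direction `d(x)`: the solution of the subproblem at `x`. -/
def dir (A : Method n m) (P : Problem n m p) (x : Vec n) : Vec n :=
  Classical.epsilon (A.Solves P x)

/-- Assumption A on the surrogates: smoothness, (strong) convexity and consistency at `d = 0`. -/
def AssumptionA (A : Method n m) (P : Problem n m p) : Prop :=
  ∃ Od Ox : Set (Vec n), IsOpen Od ∧ boxBall n A.β ⊆ Od ∧ IsOpen Ox ∧ P.K ⊆ Ox ∧
    (∀ x ∈ Ox, ContDiffOn ℝ 1 (fun d => A.ft d x) Od) ∧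
    (∀ i, ∀ x ∈ Ox, ContDiffOn ℝ 1 (fun d => A.gt i d x) Od) ∧
    (∃ c : ℝ, 0 < c ∧ ∀ x ∈ P.K, StrongConvexOn Od c (fun d => A.ft d x)) ∧
    ContinuousOn (fun z : Vec n × Vec n => A.ft z.1 z.2) (Od ×ˢ Ox) ∧
    ContinuousOn (fun z : Vec n × Vec n => gradient (fun d => A.ft d z.2) z.1) (Od ×ˢ Ox) ∧
    (∀ x ∈ P.K, gradient (fun d => A.ft d x) 0 = gradient P.f x) ∧
    (∀ i, ∀ x ∈ P.K, ConvexOn ℝ Od (fun d => A.gt i d x)) ∧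
    (∀ i, ContinuousOn (fun z : Vec n × Vec n => A.gt i z.1 z.2) (Set.univ ×ˢ Ox)) ∧
    (∀ i, ∀ x ∈ P.K, A.gt i 0 x = P.g i x) ∧
    (∀ i, ContinuousOn (fun z : Vec n × Vec n => gradient (fun d => A.gt i d z.2) z.1)
      (Od ×ˢ Ox)) ∧
    (∀ i, ∀ x ∈ P.K, gradient (fun d => A.gt i d x) 0 = gradient (P.g i) x)

/-- Assumption B on the direction: `d(·)` is Hölder continuous on the compact subsets of `K`. -/
def AssumptionB (A : Method n m) (P : Problem n m p) : Prop :=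
  ∀ S : Set (Vec n), IsCompact S → S ⊆ P.K →
    ∃ μ α : ℝ, 0 < μ ∧ 0 < α ∧
      ∀ y ∈ S, ∀ z ∈ S, ‖A.dir P y - A.dir P z‖ ≤ μ * ‖y - z‖ ^ α

/-- The stepsizes lie in `(0, 1]`, tend to zero and have a divergent sum. -/
structure IsStepsize (γ : ℕ → ℝ) : Prop where
  pos : ∀ ν, 0 < γ ν
  le_one : ∀ ν, γ ν ≤ 1
  tendsto_zero : Tendsto γ atTop (𝓝 0)
  sum_diverges : Tendsto (fun N => ∑ ν ∈ Finset.range N, γ ν) atTop atTop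

/-- `x` is the sequence generated by the algorithm with stepsizes `γ`. If the algorithm stops,
because it has reached a generalized stationary point, then the returned point is repeated. -/
structure IsRun (A : Method n m) (P : Problem n m p) (γ : ℕ → ℝ) (x : ℕ → Vec n) : Prop where
  start : x 0 ∈ P.K
  halt : ∀ ν, P.IsGenStationary (x ν) → x (ν + 1) = x ν
  step : ∀ ν, ¬ P.IsGenStationary (x ν) → x (ν + 1) = x ν + γ ν • A.dir P (x ν)

end Method

end DSM

end

open Filter Topology
open scoped RealInnerProductSpace

noncomputable section

namespace DSM

/-! The exact penalty `f + q + M φ` is a Lyapunov function for the iteration, provided that the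
multipliers of the subproblems are bounded. A point of `K` where the eMFCQ fails is already
Fritz-John or external stationary, so all the work concerns bounded runs that never halt and whose
limit points all satisfy the eMFCQ.

Separation gives every subproblem normalized Fritz John multipliers `(τ, ξ, π)`. If `τ` could tend
to `0` as `x` approaches a point satisfying the eMFCQ, the gap between `φ(x)` and `κ(x)` would close
and a limit of `(ξ, π)` would be a nonzero abnormal multiplier there, which is excluded; dividing by
`τ` therefore gives locally bounded multipliers (`exists_eventually_hasMultipliers`). With such a
bound `M`, strong convexity of `f̃` and the predicted decrease of `φ` make the merit function drop
by a multiple of `γ ‖d‖²` once `γ` is small (`exists_merit_decrease`), so `∑ γ ‖d‖²` converges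
(`summable_dir_sq`). Since `∑ γ = ∞`, some subsequence of `d` tends to `0`; Hölder continuity of
`d(·)` upgrades this to the whole sequence (`tendsto_zero_of_summable`).

Along any sequence with `d → 0`, `κ` is squeezed to `φ` at the limit. Under the eMFCQ this forces
feasibility (`infeas_eq_zero_of_tendsto`), since otherwise the surrogate violation would have a
local minimum with positive value and hence an abnormal multiplier. Passing to the limit in the
Lagrangian inequality, with a sum rule for `∂q + N_K` (`exists_subgradient_of_isMinOn`), yields the
KKT conditions (`isKKT_of_tendsto`). No continuity of `d(·)` or `κ` is used for part (i). -/

/-! ### Separation and the Fritz John alternative -/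

/-- A nonempty convex set in finite dimensions that misses the origin lies in a closed half-space
through the origin. -/
theorem exists_nonneg_functional {ι : Type*} [Fintype ι] {C : Set (ι → ℝ)} (hC : Convex ℝ C)
    (hne : C.Nonempty) (h0 : (0 : ι → ℝ) ∉ C) :
    ∃ c : ι → ℝ, c ≠ 0 ∧ ∀ u ∈ C, 0 ≤ ∑ i, c i * u i := by
  classical
  have key : ∃ f : Module.Dual ℝ (ι → ℝ), f ≠ 0 ∧ ∀ u ∈ C, 0 ≤ f u := by
    by_cases hint : (interior C).Nonempty
    · obtain ⟨f, hf, hle⟩ := geometric_hahn_banach_of_nonempty_interior_point hC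
        (fun h => h0 (interior_subset h)) hint
      refine ⟨-(f : (ι → ℝ) →ₗ[ℝ] ℝ), ?_, fun u hu => ?_⟩
      · intro h
        apply hf
        ext1 u
        have := LinearMap.congr_fun h u
        simpa using this
      · have := hle u hu
        simp only [map_zero] at this
        simpa using this
    -- With empty interior, `C` spans a proper affine subspace; a functional killing its direction
    -- is constant on `C`, and its sign can be chosen.
    · rw [hC.interior_nonempty_iff_affineSpan_eq_top] at hint
      have hdir : vectorSpan ℝ C < ⊤ := by
        refine lt_top_iff_ne_top.2 fun h => hint ?_
        exact (AffineSubspace.affineSpan_eq_top_iff_vectorSpan_eq_top_of_nonempty ℝ _ _ hne).2 h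
      obtain ⟨f, hf, hker⟩ := Submodule.exists_le_ker_of_lt_top _ hdir
      obtain ⟨p, hp⟩ := hne
      have hconst : ∀ u ∈ C, f u = f p := fun u hu => by
        have : u - p ∈ vectorSpan ℝ C := vsub_mem_vectorSpan ℝ hu hp
        have := LinearMap.mem_ker.1 (hker this)
        rwa [map_sub, sub_eq_zero] at this
      rcases le_total 0 (f p) with h | h
      · exact ⟨f, hf, fun u hu => by rw [hconst u hu]; exact h⟩
      · exact ⟨-f, neg_ne_zero.2 hf, fun u hu => by
          rw [LinearMap.neg_apply, hconst u hu]; linarith⟩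
  obtain ⟨f, hf, hpos⟩ := key
  have hrep : ∀ u, f u = ∑ i, f (Pi.single i 1) * u i := fun u => by
    rw [LinearMap.pi_apply_eq_sum_univ f u]
    refine Finset.sum_congr rfl fun i _ => ?_
    rw [smul_eq_mul, mul_comm]
    congr 2
    ext j
    simp [Pi.single_apply, eq_comm]
  refine ⟨fun i => f (Pi.single i 1), fun h => hf ?_, fun u hu => (hrep u) ▸ hpos u hu⟩
  ext i
  simpa using congrFun h i

/-- The Fritz John alternative for a convex program with inequalities `G i ≤ κ` and affine
two-sided constraints `|H j| ≤ κ`. -/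
theorem exists_fritzJohn {E : Type*} [AddCommGroup E] [Module ℝ E] {m p : ℕ} {Y : Set E}
    (hYne : Y.Nonempty) {θ : E → ℝ} (hθ : ConvexOn ℝ Y θ)
    {G : Fin m → E → ℝ} (hG : ∀ i, ConvexOn ℝ Y (G i)) {H : Fin p → E → ℝ}
    (hH : ∀ j, ∀ y ∈ Y, ∀ z ∈ Y, ∀ a b : ℝ, 0 ≤ a → 0 ≤ b → a + b = 1 →
      H j (a • y + b • z) = a * H j y + b * H j z)
    {θ₀ κ : ℝ} (hκ : 0 ≤ κ)
    (hinf : ∀ y ∈ Y, (∀ i, G i y ≤ κ) → (∀ j, |H j y| ≤ κ) → θ₀ ≤ θ y) :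
    ∃ (τ : ℝ) (ξ : Fin m → ℝ) (π : Fin p → ℝ), 0 ≤ τ ∧ (∀ i, 0 ≤ ξ i) ∧
      τ + (∑ i, ξ i + ∑ j, |π j|) = 1 ∧
      ∀ y ∈ Y, 0 ≤ τ * (θ y - θ₀) +
        (∑ i, ξ i * (G i y - κ) + ∑ j, (π j * H j y - κ * |π j|)) := by
  classical
  -- Attainable residuals with slacks: strictly positive in the objective, nonnegative in the
  -- inequalities, in a box of radius `κ` for the two-sided constraints. The origin belongs to `C`
  -- exactly when a feasible `y` has `θ y < θ₀`. The box slack yields a single signed multiplier `π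
  -- j` with penalty `κ |π j|`.
  let F : E → ℝ → (Fin m → ℝ) → (Fin p → ℝ) → (Unit ⊕ Fin m ⊕ Fin p → ℝ) := fun y s₀ s b =>
    Sum.elim (fun _ => θ y - θ₀ + s₀)
      (Sum.elim (fun i => G i y - κ + s i) (fun j => H j y + b j))
  let C : Set (Unit ⊕ Fin m ⊕ Fin p → ℝ) :=
    {u | ∃ y ∈ Y, ∃ s₀ s b, 0 < s₀ ∧ (∀ i, 0 ≤ s i) ∧ (∀ j, |b j| ≤ κ) ∧ u = F y s₀ s b}
  have hCconv : Convex ℝ C := by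
    rintro _ ⟨y, hy, s₀, s, b, hs₀, hs, hb, rfl⟩ _ ⟨y', hy', s₀', s', b', hs₀', hs', hb', rfl⟩
      α α' hα hα' hαα
    refine ⟨α • y + α' • y', hθ.1 hy hy' hα hα' hαα,
      α * s₀ + α' * s₀' + (α * θ y + α' * θ y' - θ (α • y + α' • y')),
      fun i => α * s i + α' * s' i + (α * G i y + α' * G i y' - G i (α • y + α' • y')),
      fun j => α * b j + α' * b' j, ?_, fun i => ?_, fun j => ?_, ?_⟩
    · have h1 := hθ.2 hy hy' hα hα' hαα
      simp only [smul_eq_mul] at h1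
      have h2 : 0 < α * s₀ + α' * s₀' := by
        rcases hα.eq_or_lt with rfl | hα
        · have : α' = 1 := by linarith
          subst this; simpa using hs₀'
        · have := mul_pos hα hs₀
          have := mul_nonneg hα' hs₀'.le
          linarith
      linarith
    · have h1 := (hG i).2 hy hy' hα hα' hαα
      simp only [smul_eq_mul] at h1
      have := mul_nonneg hα (hs i)
      have := mul_nonneg hα' (hs' i)
      linarith
    · calc |α * b j + α' * b' j| ≤ |α * b j| + |α' * b' j| := abs_add_le _ _
        _ = α * |b j| + α' * |b' j| := by rw [abs_mul, abs_mul, abs_of_nonneg hα, abs_of_nonneg hα']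
        _ ≤ α * κ + α' * κ := by gcongr <;> [exact hb j; exact hb' j]
        _ = κ := by rw [← add_mul, hαα, one_mul]
    · have hα2 : α' = 1 - α := by linarith
      ext (_ | i | j)
      · simp only [F, Pi.add_apply, Pi.smul_apply, Sum.elim_inl, smul_eq_mul]
        rw [hα2]; ring
      · simp only [F, Pi.add_apply, Pi.smul_apply, Sum.elim_inl, Sum.elim_inr, smul_eq_mul]
        rw [hα2]; ring
      · simp only [F, Pi.add_apply, Pi.smul_apply, Sum.elim_inr, smul_eq_mul]
        rw [hH j y hy y' hy' α α' hα hα' hαα]; ring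
  have hC0 : (0 : Unit ⊕ Fin m ⊕ Fin p → ℝ) ∉ C := by
    rintro ⟨y, hy, s₀, s, b, hs₀, hs, hb, h⟩
    have h1 : 0 = θ y - θ₀ + s₀ := congrFun h (Sum.inl ())
    have h2 : ∀ i, 0 = G i y - κ + s i := fun i => congrFun h (Sum.inr (Sum.inl i))
    have h3 : ∀ j, 0 = H j y + b j := fun j => congrFun h (Sum.inr (Sum.inr j))
    have := hinf y hy (fun i => by have := h2 i; have := hs i; linarith) (fun j => by
      have h4 : H j y = -b j := by have := h3 j; linarith
      rw [h4, abs_neg]; exact hb j)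
    linarith
  obtain ⟨y₁, hy₁⟩ := hYne
  obtain ⟨c, hc0, hc⟩ := exists_nonneg_functional hCconv
    ⟨F y₁ 1 0 0, y₁, hy₁, 1, 0, 0, one_pos, fun _ => le_rfl, fun _ => by simpa using hκ, rfl⟩ hC0
  have hval : ∀ y ∈ Y, ∀ (s₀ : ℝ) (s : Fin m → ℝ) (b : Fin p → ℝ),
      0 < s₀ → (∀ i, 0 ≤ s i) → (∀ j, |b j| ≤ κ) →
      0 ≤ c (Sum.inl ()) * (θ y - θ₀ + s₀) + (∑ i, c (Sum.inr (Sum.inl i)) * (G i y - κ + s i) +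
        ∑ j, c (Sum.inr (Sum.inr j)) * (H j y + b j)) := by
    intro y hy s₀ s b hs₀ hs hb
    have := hc (F y s₀ s b) ⟨y, hy, s₀, s, b, hs₀, hs, hb, rfl⟩
    simpa [F, Fintype.sum_sum_type] using this
  set τ := c (Sum.inl ()) with hτ
  set ξ : Fin m → ℝ := fun i => c (Sum.inr (Sum.inl i)) with hξ
  set π : Fin p → ℝ := fun j => c (Sum.inr (Sum.inr j)) with hπ
  -- Sending one slack to infinity forces the sign of its multiplier.
  have unbdd : ∀ a b : ℝ, (∀ t : ℝ, 0 < t → 0 ≤ a * t + b) → 0 ≤ a := by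
    intro a b h
    by_contra ha
    push Not at ha
    have ht : 0 < (|b| + 1) / (-a) := by
      have := abs_nonneg b
      apply div_pos <;> linarith
    have := h _ ht
    rw [mul_div_assoc', div_neg, mul_div_assoc, mul_div_cancel₀ _ ha.ne] at this
    have := le_abs_self b
    linarith
  have hτ0 : 0 ≤ τ := by
    refine unbdd τ (τ * (θ y₁ - θ₀) + (∑ i, ξ i * (G i y₁ - κ) + ∑ j, π j * H j y₁)) fun t ht => ?_
    have := hval y₁ hy₁ t 0 0 ht (fun _ => le_rfl) (fun _ => by simpa using hκ)
    simp only [Pi.zero_apply, add_zero] at this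
    linarith
  have hξ0 : ∀ i, 0 ≤ ξ i := by
    intro i₀
    refine unbdd (ξ i₀)
      (τ * (θ y₁ - θ₀ + 1) + (∑ i, ξ i * (G i y₁ - κ) + ∑ j, π j * H j y₁)) fun t ht => ?_
    have := hval y₁ hy₁ 1 (Pi.single i₀ t) 0 one_pos
      (fun i => by
        by_cases h : i = i₀
        · subst h; simpa using ht.le
        · simp [h]) (fun _ => by simpa using hκ)
    simp only [Pi.zero_apply, add_zero, mul_add, Finset.sum_add_distrib] at this
    have h2 : ∑ i, c (Sum.inr (Sum.inl i)) * (Pi.single i₀ t : Fin m → ℝ) i = ξ i₀ * t := by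
      simp [Pi.single_apply, hξ]
    rw [h2] at this
    linarith
  have hmain : ∀ y ∈ Y, 0 ≤ τ * (θ y - θ₀) +
        (∑ i, ξ i * (G i y - κ) + ∑ j, (π j * H j y - κ * |π j|)) := by
    intro y hy
    have hlim : ∀ t : ℝ, 0 < t → 0 ≤ τ * (θ y - θ₀) +
        (∑ i, ξ i * (G i y - κ) + ∑ j, (π j * H j y - κ * |π j|)) + τ * t := by
      intro t ht
      -- The worst slack in the box contributes `-κ |π j|`; the objective slack `t` is sent to `0`
      -- afterwards.
      have := hval y hy t 0 (fun j => -(κ * SignType.sign (π j))) ht (fun _ => le_rfl) (fun j => by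
        rw [abs_neg, abs_mul, abs_of_nonneg hκ]
        have : |((SignType.sign (π j) : SignType) : ℝ)| ≤ 1 := by
          rcases lt_trichotomy (π j) 0 with h | h | h <;> simp [h]
        nlinarith)
      have h2 : ∑ j, c (Sum.inr (Sum.inr j)) * (H j y + -(κ * SignType.sign (π j))) =
          ∑ j, (π j * H j y - κ * |π j|) := by
        refine Finset.sum_congr rfl fun j _ => ?_
        have h3 : π j * ((SignType.sign (π j) : SignType) : ℝ) = |π j| := self_mul_sign _
        rw [← h3]
        simp only [hπ]
        ring
      rw [h2] at this
      simp only [Pi.zero_apply, add_zero] at this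
      linarith
    refine le_of_forall_pos_le_add fun ε hε => ?_
    rcases hτ0.eq_or_lt with h | h
    · have := hlim 1 one_pos
      rw [← h] at this ⊢
      linarith
    · have := hlim (ε / τ) (div_pos hε h)
      rwa [mul_div_cancel₀ _ h.ne'] at this
  have hsum : 0 < τ + (∑ i, ξ i + ∑ j, |π j|) := by
    have h1 : 0 ≤ ∑ i, ξ i := Finset.sum_nonneg fun i _ => hξ0 i
    have h2 : 0 ≤ ∑ j, |π j| := Finset.sum_nonneg fun j _ => abs_nonneg _
    by_contra hneg
    have e1 : τ = 0 := by linarith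
    have e2 : ∑ i, ξ i = 0 := by linarith
    have e3 : ∑ j, |π j| = 0 := by linarith
    rw [Finset.sum_eq_zero_iff_of_nonneg fun i _ => hξ0 i] at e2
    rw [Finset.sum_eq_zero_iff_of_nonneg fun i _ => abs_nonneg _] at e3
    apply hc0
    ext (_ | i | j)
    · exact e1
    · exact e2 i (Finset.mem_univ _)
    · exact abs_eq_zero.1 (e3 j (Finset.mem_univ _))
  set s := τ + (∑ i, ξ i + ∑ j, |π j|) with hs
  refine ⟨s⁻¹ * τ, fun i => s⁻¹ * ξ i, fun j => s⁻¹ * π j, mul_nonneg (inv_nonneg.2 hsum.le) hτ0,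
    fun i => mul_nonneg (inv_nonneg.2 hsum.le) (hξ0 i), ?_, fun y hy => ?_⟩
  · have : ∀ j, |s⁻¹ * π j| = s⁻¹ * |π j| := fun j => by
      rw [abs_mul, abs_of_nonneg (inv_nonneg.2 hsum.le)]
    simp only [this, ← Finset.mul_sum, ← mul_add]
    rw [← hs, inv_mul_cancel₀ hsum.ne']
  · have h := mul_nonneg (inv_nonneg.2 hsum.le) (hmain y hy)
    have e : ∀ j, |s⁻¹ * π j| = s⁻¹ * |π j| := fun j => by
      rw [abs_mul, abs_of_nonneg (inv_nonneg.2 hsum.le)]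
    refine h.trans_eq ?_
    simp only [e, mul_add, Finset.mul_sum]
    congr 1
    · ring
    · congr 1 <;> refine Finset.sum_congr rfl fun i _ => by ring

/-! ### One-sided derivatives and gradients -/

theorem deriv_nonneg_of_eventually_nonneg {ψ : ℝ → ℝ} {a : ℝ} (h : HasDerivAt ψ a 0)
    (h0 : ψ 0 = 0) (hpos : ∀ᶠ t in 𝓝[>] (0 : ℝ), 0 ≤ ψ t) : 0 ≤ a := by
  refine ge_of_tendsto h.tendsto_slope_zero_right ?_
  filter_upwards [hpos, self_mem_nhdsWithin] with t ht ht0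
  have : (0 : ℝ) < t := ht0
  simp only [zero_add, h0, sub_zero, smul_eq_mul]
  positivity

variable {n : ℕ}

theorem HasGradientAt.hasDerivAt_line {F : Vec n → ℝ} {G x : Vec n} (h : HasGradientAt F G x)
    (v : Vec n) : HasDerivAt (fun t : ℝ => F (x + t • v)) ⟪G, v⟫ 0 := by
  have h1 : HasDerivAt (fun t : ℝ => x + t • v) v 0 := by
    simpa using ((hasDerivAt_id (0 : ℝ)).smul_const v).const_add x
  have h2 : HasFDerivAt F (InnerProductSpace.toDual ℝ (Vec n) G) (x + (0 : ℝ) • v) := by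
    simpa using h.hasFDerivAt
  have h3 := h2.comp_hasDerivAt (0 : ℝ) h1
  rw [InnerProductSpace.toDual_apply_apply] at h3
  exact h3

/-- The gap in the strong convexity inequality on the segment from `x` to `y` is nonnegative and
vanishes at `x`, so its one-sided derivative there is nonnegative. Differentiability is needed at
`x` only. -/
theorem StrongConvexOn.add_inner_le {F : Vec n → ℝ} {S : Set (Vec n)} {c : ℝ}
    (hF : StrongConvexOn S c F) {x y G : Vec n} (hx : x ∈ S) (hy : y ∈ S)
    (hG : HasGradientAt F G x) : F x + ⟪G, y - x⟫ + c / 2 * ‖y - x‖ ^ 2 ≤ F y := by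
  have h1 := HasGradientAt.hasDerivAt_line hG (y - x)
  have h2 : HasDerivAt (fun t : ℝ => t * (F y - F x) - t * (1 - t) * (c / 2 * ‖y - x‖ ^ 2))
      (F y - F x - c / 2 * ‖y - x‖ ^ 2) 0 := by
    have e1 : HasDerivAt (fun t : ℝ => t * (F y - F x)) (F y - F x) 0 := by
      simpa using (hasDerivAt_id (0 : ℝ)).mul_const (F y - F x)
    have e2 : HasDerivAt (fun t : ℝ => t * (1 - t)) 1 0 := by
      simpa using (hasDerivAt_id (0 : ℝ)).fun_mul ((hasDerivAt_id (0 : ℝ)).const_sub 1)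
    simpa using e1.fun_sub (e2.mul_const (c / 2 * ‖y - x‖ ^ 2))
  have h3 := h2.sub (h1.sub_const (F x))
  have h4 := deriv_nonneg_of_eventually_nonneg h3 (by simp) (by
    have : ∀ᶠ t in 𝓝[>] (0 : ℝ), t < 1 := nhdsWithin_le_nhds (Iio_mem_nhds one_pos)
    filter_upwards [self_mem_nhdsWithin, this] with t ht ht1
    have ht0 : (0 : ℝ) < t := ht
    have := hF.2 hx hy (by linarith : 0 ≤ 1 - t) ht0.le (by ring)
    have e : (1 - t) • x + t • y = x + t • (y - x) := by
      rw [sub_smul, one_smul, smul_sub]; abel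
    rw [e, norm_sub_rev x y] at this
    simp only [smul_eq_mul] at this
    simp only [Pi.sub_apply]
    nlinarith)
  linarith

theorem ConvexOn.add_inner_le {F : Vec n → ℝ} {S : Set (Vec n)}
    (hF : ConvexOn ℝ S F) {x y G : Vec n} (hx : x ∈ S) (hy : y ∈ S)
    (hG : HasGradientAt F G x) : F x + ⟪G, y - x⟫ ≤ F y := by
  have := StrongConvexOn.add_inner_le (strongConvexOn_zero.2 hF) hx hy hG
  simpa using this

theorem hasGradientAt_of_contDiffOn {F : Vec n → ℝ} {U : Set (Vec n)} (hU : IsOpen U)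
    (hF : ContDiffOn ℝ 1 F U) {x : Vec n} (hx : x ∈ U) : HasGradientAt F (gradient F x) x :=
  ((hF.differentiableOn (by norm_num)).differentiableAt (hU.mem_nhds hx)).hasGradientAt

theorem IsC11Near.continuousOn {K : Set (Vec n)} {F : Vec n → ℝ} (h : IsC11Near K F) :
    ContinuousOn F K := by
  obtain ⟨U, -, hKU, hF, -⟩ := h
  exact hF.continuousOn.mono hKU

theorem IsC11Near.continuousOn_gradient {K : Set (Vec n)} {F : Vec n → ℝ} (h : IsC11Near K F) :
    ContinuousOn (gradient F) K := by
  obtain ⟨U, -, hKU, -, hF⟩ := h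
  exact hF.continuousOn.mono hKU

/-- The quadratic upper and lower bounds for a function with locally Lipschitz gradient, uniformly
on a compact convex set. -/
theorem IsC11Near.exists_quadratic_bound {K T : Set (Vec n)} {F : Vec n → ℝ} (h : IsC11Near K F)
    (hTK : T ⊆ K) (hT : IsCompact T) (hTc : Convex ℝ T) :
    ∃ L : ℝ, 0 ≤ L ∧ ∀ x ∈ T, ∀ v, x + v ∈ T →
      |F (x + v) - F x - ⟪gradient F x, v⟫| ≤ L * ‖v‖ ^ 2 := by
  obtain ⟨U, hU, hKU, hF, hlip⟩ := h
  obtain ⟨L, hL⟩ := (hlip.mono (hTK.trans hKU)).exists_lipschitzOnWith_of_compact hT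
  refine ⟨L, L.2, fun x hx v hv => ?_⟩
  have hseg : segment ℝ x (x + v) ⊆ T := hTc.segment_subset hx hv
  have key := (convex_segment (𝕜 := ℝ) x (x + v)).norm_image_sub_le_of_norm_hasFDerivWithin_le'
    (f := F) (f' := fun z => InnerProductSpace.toDual ℝ (Vec n) (gradient F z))
    (φ := InnerProductSpace.toDual ℝ (Vec n) (gradient F x)) (C := L * ‖v‖)
    (fun z hz => (hasGradientAt_of_contDiffOn hU hF
      (hKU (hTK (hseg hz)))).hasFDerivAt.hasFDerivWithinAt)
    (fun z hz => by
      rw [← map_sub, LinearIsometryEquiv.norm_map, ← dist_eq_norm]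
      refine (hL.dist_le_mul z (hseg hz) x hx).trans ?_
      gcongr
      rw [dist_eq_norm]
      have := norm_sub_le_of_mem_segment hz
      simpa using this)
    (left_mem_segment ℝ x (x + v)) (right_mem_segment ℝ x (x + v))
  simp only [add_sub_cancel_left, InnerProductSpace.toDual_apply_apply, Real.norm_eq_abs] at key
  refine key.trans_eq (by ring)

variable {n m p : ℕ}

/-! ### The violation and the boxes -/

/-- The conjunct `0 ≤ t` accounts both for the positive parts and for the case without indices,
where the suprema are `0`. -/
theorem maxViolation_le_iff {u : Fin m → ℝ} {v : Fin p → ℝ} {t : ℝ} :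
    maxViolation u v ≤ t ↔ 0 ≤ t ∧ (∀ i, u i ≤ t) ∧ ∀ j, |v j| ≤ t := by
  constructor
  · intro h
    have h1 := (max_le_iff.1 h).1
    have h2 := (max_le_iff.1 h).2
    have h0 : 0 ≤ ⨆ j, |v j| := Real.iSup_nonneg fun _ => abs_nonneg _
    refine ⟨h0.trans h2, fun i => ?_, fun j => ?_⟩
    · exact (le_max_left _ _).trans
        ((le_ciSup (f := fun i => max (u i) 0) (Set.finite_range _).bddAbove i).trans h1)
    · exact (le_ciSup (f := fun j => |v j|) (Set.finite_range _).bddAbove j).trans h2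
  · rintro ⟨h0, h1, h2⟩
    exact max_le (Real.iSup_le (fun i => max_le (h1 i) h0) h0) (Real.iSup_le h2 h0)

theorem maxViolation_nonneg (u : Fin m → ℝ) (v : Fin p → ℝ) : 0 ≤ maxViolation u v :=
  (maxViolation_le_iff.1 le_rfl).1

theorem le_maxViolation_left (u : Fin m → ℝ) (v : Fin p → ℝ) (i : Fin m) :
    u i ≤ maxViolation u v :=
  (maxViolation_le_iff.1 le_rfl).2.1 i

theorem le_maxViolation_right (u : Fin m → ℝ) (v : Fin p → ℝ) (j : Fin p) :
    |v j| ≤ maxViolation u v :=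
  (maxViolation_le_iff.1 le_rfl).2.2 j

/-- Seen as a sup norm, the violation is visibly continuous. -/
theorem maxViolation_eq_norm (u : Fin m → ℝ) (v : Fin p → ℝ) :
    maxViolation u v = ‖((fun i => max (u i) 0 : Fin m → ℝ), v)‖ := by
  apply le_antisymm
  · refine maxViolation_le_iff.2 ⟨norm_nonneg _, fun i => ?_, fun j => ?_⟩
    · calc u i ≤ max (u i) 0 := le_max_left _ _
        _ ≤ ‖max (u i) 0‖ := Real.le_norm_self _
        _ ≤ ‖(fun i => max (u i) 0 : Fin m → ℝ)‖ :=
          norm_le_pi_norm (fun i => max (u i) 0 : Fin m → ℝ) i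
        _ ≤ _ := norm_fst_le ((fun i => max (u i) 0 : Fin m → ℝ), v)
    · exact (norm_le_pi_norm v j).trans (norm_snd_le ((fun i => max (u i) 0 : Fin m → ℝ), v))
  · have h0 := maxViolation_nonneg u v
    refine norm_prod_le_iff.2 ⟨(pi_norm_le_iff_of_nonneg h0).2 fun i => ?_,
      (pi_norm_le_iff_of_nonneg h0).2 fun j => le_maxViolation_right u v j⟩
    rw [Real.norm_eq_abs, abs_of_nonneg (le_max_right _ _)]
    exact max_le (le_maxViolation_left u v i) h0

theorem continuous_maxViolation :
    Continuous fun w : (Fin m → ℝ) × (Fin p → ℝ) => maxViolation w.1 w.2 := by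
  simp only [maxViolation_eq_norm]
  fun_prop

theorem ContinuousOn.maxViolation {X : Type*} [TopologicalSpace X] {s : Set X}
    {u : Fin m → X → ℝ} {v : Fin p → X → ℝ} (hu : ∀ i, ContinuousOn (u i) s)
    (hv : ∀ j, ContinuousOn (v j) s) :
    ContinuousOn (fun z => maxViolation (fun i => u i z) (fun j => v j z)) s :=
  continuous_maxViolation.comp_continuousOn
    ((continuousOn_pi.2 hu).prodMk (continuousOn_pi.2 hv))

theorem continuous_coord (i : Fin n) : Continuous fun u : Vec n => u i := by fun_prop

theorem isCompact_boxBall (r : ℝ) : IsCompact (boxBall n r) := by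
  have h := (EuclideanSpace.equiv (Fin n) ℝ).toHomeomorph.isClosedEmbedding.isCompact_preimage
    (isCompact_univ_pi fun _ : Fin n => isCompact_Icc (a := -r) (b := r))
  convert h using 1
  ext u
  simp only [boxBall, abs_le, Set.mem_preimage, Set.mem_univ_pi, Set.mem_Icc]
  rfl

theorem convex_boxBall (r : ℝ) : Convex ℝ (boxBall n r) := by
  intro u hu v hv a b ha hb hab i
  calc |(a • u + b • v) i| = |a * u i + b * v i| := by simp
    _ ≤ |a * u i| + |b * v i| := abs_add_le _ _
    _ = a * |u i| + b * |v i| := by rw [abs_mul, abs_mul, abs_of_nonneg ha, abs_of_nonneg hb]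
    _ ≤ a * r + b * r := by gcongr <;> [exact hu i; exact hv i]
    _ = r := by rw [← add_mul, hab, one_mul]

theorem zero_mem_boxBall {r : ℝ} (hr : 0 ≤ r) : (0 : Vec n) ∈ boxBall n r := fun i => by
  simpa using hr

theorem boxBall_mono {r s : ℝ} (h : r ≤ s) : boxBall n r ⊆ boxBall n s :=
  fun _ hu i => (hu i).trans h

theorem isOpen_openBox (r : ℝ) : IsOpen {u : Vec n | ∀ i, |u i| < r} := by
  simp only [Set.ofPred_forall]
  exact isOpen_iInter_of_finite fun i => isOpen_lt (continuous_coord i).abs continuous_const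

theorem eventually_smul_mem_openBox {r : ℝ} (hr : 0 < r) (y : Vec n) :
    ∀ᶠ t in 𝓝[>] (0 : ℝ), ∀ i, |(t • y) i| < r := by
  have h : Tendsto (fun t : ℝ => t • y) (𝓝 0) (𝓝 0) := by
    have : Continuous fun t : ℝ => t • y := by fun_prop
    simpa using this.tendsto 0
  exact nhdsWithin_le_nhds (h.eventually ((isOpen_openBox r).mem_nhds fun i => by simpa using hr))

/-! ### Normal cones of the orthant and of the box -/

theorem mem_normalCone_nonposOrthant {u ξ : Fin m → ℝ} (hu : ∀ i, u i ≤ 0) (hξ : ∀ i, 0 ≤ ξ i)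
    (h : ∀ i, ξ i * u i = 0) :
    WithLp.toLp 2 ξ ∈ normalCone (nonposOrthant m) (WithLp.toLp 2 u) := by
  refine ⟨hu, fun y hy => ?_⟩
  rw [PiLp.inner_apply]
  refine Finset.sum_nonpos fun i _ => ?_
  have h1 := mul_nonpos_of_nonneg_of_nonpos (hξ i) (hy i)
  have h2 := h i
  simp only [PiLp.sub_apply, RCLike.inner_apply, conj_trivial]
  linarith

/-- The condition `h` says that `v` attains the support function of the box in the direction `π`,
coordinate by coordinate. -/
theorem mem_normalCone_boxBall {v π : Fin p → ℝ} {r : ℝ} (hv : ∀ j, |v j| ≤ r)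
    (h : ∀ j, π j * v j = r * |π j|) :
    WithLp.toLp 2 π ∈ normalCone (boxBall p r) (WithLp.toLp 2 v) := by
  refine ⟨hv, fun y hy => ?_⟩
  rw [PiLp.inner_apply]
  refine Finset.sum_nonpos fun j _ => ?_
  have h1 : π j * y j ≤ r * |π j| := by
    calc π j * y j ≤ |π j * y j| := le_abs_self _
      _ = |π j| * |y j| := abs_mul _ _
      _ ≤ |π j| * r := by gcongr; exact hy j
      _ = r * |π j| := mul_comm _ _
  have h2 := h j
  simp only [PiLp.sub_apply, RCLike.inner_apply, conj_trivial]
  linarith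

/-! ### The sum rule for `∂q + N_K` -/

/-- Local Lipschitz continuity of `q` replaces an interior-point qualification, so `D` may be `K`
itself. Decouple the argument `z ∈ D` of `q` from the point `w ∈ K`: minimality and the Lipschitz
bound keep the set `C` of pairs `(z - w, value)` off the open cone `N` below `-L ‖·‖`. The
horizontal part of a separating functional gives `v` on taking `w = x`, and `ζ` on taking `z = x`.
-/
theorem exists_subgradient_of_isMinOn {K D : Set (Vec n)} (hK : Convex ℝ K) (hKD : K ⊆ D)
    {q : Vec n → ℝ} (hq : ConvexOn ℝ D q)
    (hlip : ∃ U : Set (Vec n), IsOpen U ∧ K ⊆ U ∧ LocallyLipschitzOn U q)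
    {x a : Vec n} (hx : x ∈ K) (hmin : ∀ z ∈ K, q x ≤ q z + ⟪a, z - x⟫) :
    ∃ v ∈ subdiff D q x, ∃ ζ ∈ normalCone K x, a + v + ζ = 0 := by
  obtain ⟨U, hU, hKU, hUq⟩ := hlip
  obtain ⟨L, W, hW, hL⟩ := hUq (hKU hx)
  rw [hU.nhdsWithin_eq (hKU hx)] at hW
  obtain ⟨r, hr, hrW⟩ := Metric.mem_nhds_iff.1 hW
  set B := Metric.ball x r with hB
  have hxB : x ∈ B := Metric.mem_ball_self hr
  have hBc : Convex ℝ B := convex_ball x r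
  have hLB : ∀ z ∈ B, ∀ w ∈ B, q w ≤ q z + L * ‖z - w‖ := fun z hz w hw => by
    have := hL.dist_le_mul w (hrW hw) z (hrW hz)
    rw [Real.dist_eq, dist_eq_norm, norm_sub_rev] at this
    have := (abs_le.1 this).2
    linarith
  let C : Set (Vec n × ℝ) := {c | ∃ z ∈ D ∩ B, ∃ w ∈ K ∩ B,
    c.1 = z - w ∧ q z - q x + ⟪a, w - x⟫ ≤ c.2}
  let N : Set (Vec n × ℝ) := {c | c.2 < -(L * ‖c.1‖)}
  have hNo : IsOpen N := isOpen_lt (by fun_prop) (by fun_prop)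
  have hNc : Convex ℝ N := by
    intro c hc c' hc' s t hs ht hst
    simp only [N, Set.mem_ofPred_eq, Prod.fst_add, Prod.snd_add, Prod.smul_fst, Prod.smul_snd,
      smul_eq_mul] at hc hc' ⊢
    have h1 : ‖s • c.1 + t • c'.1‖ ≤ s * ‖c.1‖ + t * ‖c'.1‖ := by
      refine (norm_add_le _ _).trans_eq ?_
      rw [norm_smul, norm_smul, Real.norm_of_nonneg hs, Real.norm_of_nonneg ht]
    have h2 := mul_le_mul_of_nonneg_left h1 L.2
    change (L : ℝ) * _ ≤ (L : ℝ) * _ at h2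
    have h3 : s * c.2 + t * c'.2 < s * -(L * ‖c.1‖) + t * -(L * ‖c'.1‖) := by
      rcases hs.eq_or_lt with rfl | hs
      · have : t = 1 := by linarith
        subst this; simpa using hc'
      · have := mul_lt_mul_of_pos_left hc hs
        have := mul_le_mul_of_nonneg_left hc'.le ht
        linarith
    linarith
  have hCc : Convex ℝ C := by
    rintro c ⟨z, hz, w, hw, h1, h2⟩ c' ⟨z', hz', w', hw', h1', h2'⟩ s t hs ht hst
    refine ⟨s • z + t • z', ⟨hq.1 hz.1 hz'.1 hs ht hst, hBc hz.2 hz'.2 hs ht hst⟩,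
      s • w + t • w', ⟨hK hw.1 hw'.1 hs ht hst, hBc hw.2 hw'.2 hs ht hst⟩, ?_, ?_⟩
    · simp only [Prod.fst_add, Prod.smul_fst, h1, h1', smul_sub]
      abel
    · have h3 := hq.2 hz.1 hz'.1 hs ht hst
      simp only [smul_eq_mul] at h3
      simp only [Prod.snd_add, Prod.smul_snd, smul_eq_mul, inner_sub_right, inner_add_right,
        real_inner_smul_right] at h2 h2' ⊢
      have h4 := mul_le_mul_of_nonneg_left h2 hs
      have h5 := mul_le_mul_of_nonneg_left h2' ht
      have h6 : t = 1 - s := by linarith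
      subst h6
      nlinarith
  have hdisj : Disjoint N C := by
    rw [Set.disjoint_left]
    rintro c hcN ⟨z, hz, w, hw, h1, h2⟩
    have h3 : c.2 < -(L * ‖z - w‖) := by rw [← h1]; exact hcN
    have h4 := hLB z hz.2 w hw.2
    have h5 := hmin w hw.1
    linarith
  obtain ⟨f, u, hfN, hfC⟩ := geometric_hahn_banach_open hNc hNo hCc hdisj
  have hrep : ∀ c : Vec n × ℝ, f c =
      ⟪(InnerProductSpace.toDual ℝ (Vec n)).symm (f.comp (ContinuousLinearMap.inl ℝ _ _)), c.1⟫ +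
        f (0, 1) * c.2 := by
    intro c
    rw [InnerProductSpace.toDual_symm_apply]
    have : c = (c.1, 0) + c.2 • ((0 : Vec n), (1 : ℝ)) := by ext <;> simp
    conv_lhs => rw [this, map_add, map_smul]
    simp [mul_comm]
  set b := (InnerProductSpace.toDual ℝ (Vec n)).symm (f.comp (ContinuousLinearMap.inl ℝ _ _))
  set σ := f (0, 1)
  -- The separating level is `0`: `(0, 0)` lies in `C`, and `(0, -t)` lies in `N` for arbitrarily
  -- small `t > 0`. Taking `t = 1` then makes the vertical coefficient `σ` positive.
  have hu0 : u ≤ 0 := by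
    have := hfC (0, 0) ⟨x, ⟨hKD hx, hxB⟩, x, ⟨hx, hxB⟩, by simp, by simp⟩
    rw [hrep] at this
    simpa using this
  have hu1 : ∀ t : ℝ, 0 < t → σ * (-t) < u := fun t ht => by
    have := hfN (0, -t) (by simpa [N] using ht)
    rw [hrep] at this
    simpa using this
  have hu : u = 0 := by
    refine le_antisymm hu0 (le_of_forall_pos_le_add fun ε hε => ?_)
    by_contra hneg
    push Not at hneg
    have hlim : Tendsto (fun t : ℝ => σ * (-t)) (𝓝[>] 0) (𝓝 0) := by
      have : Continuous fun t : ℝ => σ * (-t) := by fun_prop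
      simpa using (this.tendsto 0).mono_left nhdsWithin_le_nhds
    have := le_of_tendsto hlim (by
      filter_upwards [self_mem_nhdsWithin] with t ht using (hu1 t ht).le)
    linarith
  subst hu
  have hσ : 0 < σ := by have := hu1 1 one_pos; linarith
  have hkey : ∀ z ∈ D ∩ B, ∀ w ∈ K ∩ B,
      0 ≤ ⟪σ⁻¹ • b, z - w⟫ + (q z - q x + ⟪a, w - x⟫) := fun z hz w hw => by
    have := hfC (z - w, q z - q x + ⟪a, w - x⟫) ⟨z, hz, w, hw, rfl, le_rfl⟩
    rw [hrep] at this
    have h2 := mul_nonneg (inv_nonneg.2 hσ.le) this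
    rw [mul_add, ← mul_assoc, inv_mul_cancel₀ hσ.ne', one_mul, ← real_inner_smul_left] at h2
    exact h2
  -- Shrinking towards `x` brings any point into the ball; convexity makes the local inequality
  -- global.
  have hscale : ∀ {S : Set (Vec n)}, Convex ℝ S → x ∈ S → ∀ y ∈ S,
      ∃ t : ℝ, 0 < t ∧ t ≤ 1 ∧ x + t • (y - x) ∈ S ∩ B := fun {S} hS hxS y hy => by
    have h1 : Tendsto (fun t : ℝ => x + t • (y - x)) (𝓝[>] 0) (𝓝 x) := by
      have : Continuous fun t : ℝ => x + t • (y - x) := by fun_prop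
      simpa using (this.tendsto 0).mono_left nhdsWithin_le_nhds
    have h2 : ∀ᶠ t in 𝓝[>] (0 : ℝ), t < 1 := nhdsWithin_le_nhds (Iio_mem_nhds one_pos)
    obtain ⟨t, ht1, ht2, ht3⟩ := ((h1.eventually (Metric.ball_mem_nhds x hr)).and
      (h2.and self_mem_nhdsWithin)).exists
    have ht0 : 0 < t := ht3
    refine ⟨t, ht0, ht2.le, ?_, ht1⟩
    have := hS hxS hy (by linarith : 0 ≤ 1 - t) ht0.le (by ring)
    convert this using 1
    rw [sub_smul, one_smul, smul_sub]; abel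
  refine ⟨-(σ⁻¹ • b), fun y hy => ?_, σ⁻¹ • b - a, ⟨hx, fun y hy => ?_⟩, by abel⟩
  · obtain ⟨t, ht0, ht1, htS⟩ := hscale hq.1 (hKD hx) y hy
    have h1 := hkey _ htS x ⟨hx, hxB⟩
    have h2 := hq.2 (hKD hx) hy (by linarith : 0 ≤ 1 - t) ht0.le (by ring)
    have e : (1 - t) • x + t • y = x + t • (y - x) := by
      rw [sub_smul, one_smul, smul_sub]; abel
    rw [e] at h2
    simp only [smul_eq_mul] at h2
    simp only [add_sub_cancel_left, sub_self, inner_zero_right, add_zero,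
      real_inner_smul_right _ _ t] at h1
    rw [inner_neg_left]
    have h3 : 0 ≤ t * (⟪σ⁻¹ • b, y - x⟫ + q y - q x) := by linarith
    have := nonneg_of_mul_nonneg_right h3 ht0
    linarith
  · obtain ⟨t, ht0, ht1, htS⟩ := hscale hK hx y hy
    have h1 := hkey x ⟨hKD hx, hxB⟩ _ htS
    simp only [add_sub_cancel_left, sub_self, zero_add, sub_add_cancel_left, inner_neg_right,
      real_inner_smul_right _ _ t] at h1
    rw [inner_sub_left]
    have h3 : 0 ≤ t * (⟪a, y - x⟫ - ⟪σ⁻¹ • b, y - x⟫) := by linarith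
    have := nonneg_of_mul_nonneg_right h3 ht0
    linarith

/-! ### The subproblem, its Lagrangian and its multipliers -/

namespace Method

variable {n m p : ℕ}

/-- What the convergence proof uses of the assumptions on the problem and on the surrogates. -/
structure Regular (A : Method n m) (P : Problem n m p) (c : ℝ) : Prop where
  standing : P.Standing
  admissible : A.Admissible
  modulus_pos : 0 < c
  ft_strongConvex : ∀ x ∈ P.K, StrongConvexOn (boxBall n A.β) c fun d => A.ft d x
  ft_continuousOn : ContinuousOn (fun z : Vec n × Vec n => A.ft z.1 z.2) (boxBall n A.β ×ˢ P.K)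
  ft_gradient : ∀ x ∈ P.K, HasGradientAt (fun d => A.ft d x) (gradient P.f x) 0
  gt_convex : ∀ i, ∀ x ∈ P.K, ConvexOn ℝ (boxBall n A.β) fun d => A.gt i d x
  gt_continuousOn : ∀ i,
    ContinuousOn (fun z : Vec n × Vec n => A.gt i z.1 z.2) (Set.univ ×ˢ P.K)
  gt_zero : ∀ i, ∀ x ∈ P.K, A.gt i 0 x = P.g i x
  gt_gradient : ∀ i, ∀ x ∈ P.K, HasGradientAt (fun d => A.gt i d x) (gradient (P.g i) x) 0

theorem AssumptionA.exists_regular {A : Method n m} {P : Problem n m p} (hP : P.Standing)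
    (hA : A.Admissible) (h : A.AssumptionA P) : ∃ c, A.Regular P c := by
  obtain ⟨Od, Ox, hOd, hβ, hOx, hK, hft, hgt, ⟨c, hc, hsc⟩, hftc, -, hftg, hgtc, hgtcont, hgt0, -,
    hgtg⟩ := h
  have h0 : (0 : Vec n) ∈ Od := hβ (zero_mem_boxBall hA.β_pos.le)
  refine ⟨c, hP, hA, hc, fun x hx => ?_, hftc.mono (Set.prod_mono hβ hK), fun x hx => ?_,
    fun i x hx => (hgtc i x hx).subset hβ (convex_boxBall _),
    fun i => (hgtcont i).mono (Set.prod_mono le_rfl hK), hgt0, fun i x hx => ?_⟩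
  · exact ⟨convex_boxBall _, fun y hy z hz a b ha hb hab =>
      (hsc x hx).2 (hβ hy) (hβ hz) ha hb hab⟩
  · rw [← hftg x hx]
    exact hasGradientAt_of_contDiffOn hOd (hft x (hK hx)) h0
  · rw [← hgtg i x hx]
    exact hasGradientAt_of_contDiffOn hOd (hgt i x (hK hx)) h0

/-- The violation of the surrogate constraints by the step `d` at `x`. -/
def viol (A : Method n m) (P : Problem n m p) (d x : Vec n) : ℝ :=
  maxViolation (fun i => A.gt i d x) (fun j => ht P j d x)

/-- The objective of the subproblem at `x`. -/
def obj (A : Method n m) (P : Problem n m p) (d x : Vec n) : ℝ :=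
  A.ft d x + P.q (x + d)

/-- The constraint part of the Lagrangian of the subproblem at `x` with relaxation `κ`. -/
def lagr (A : Method n m) (P : Problem n m p) (κ : ℝ) (ξ : Fin m → ℝ) (π : Fin p → ℝ)
    (d x : Vec n) : ℝ :=
  ∑ i, ξ i * (A.gt i d x - κ) + ∑ j, (π j * ht P j d x - κ * |π j|)

/-- The subproblem at `x` has Lagrange multipliers of `ℓ¹`-norm at most `M`. -/
def HasMultipliers (A : Method n m) (P : Problem n m p) (M : ℝ) (x : Vec n) : Prop :=
  ∃ (ξ : Fin m → ℝ) (π : Fin p → ℝ), (∀ i, 0 ≤ ξ i) ∧ ∑ i, ξ i + ∑ j, |π j| ≤ M ∧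
    ∀ d ∈ boxBall n A.β, x + d ∈ P.K →
      0 ≤ A.obj P d x - A.obj P (A.dir P x) x + A.lagr P (A.kappa P x) ξ π d x

theorem HasMultipliers.mono {A : Method n m} {P : Problem n m p} {M M' : ℝ} {x : Vec n}
    (h : A.HasMultipliers P M x) (hM : M ≤ M') : A.HasMultipliers P M' x := by
  obtain ⟨ξ, π, h1, h2, h3⟩ := h
  exact ⟨ξ, π, h1, h2.trans hM, h3⟩

theorem gt_le_viol (A : Method n m) (P : Problem n m p) (d x : Vec n) (i : Fin m) :
    A.gt i d x ≤ A.viol P d x :=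
  le_maxViolation_left (fun i => A.gt i d x) (fun j => ht P j d x) i

theorem abs_ht_le_viol (A : Method n m) (P : Problem n m p) (d x : Vec n) (j : Fin p) :
    |ht P j d x| ≤ A.viol P d x :=
  le_maxViolation_right (fun i => A.gt i d x) (fun j => ht P j d x) j

theorem g_le_infeas (P : Problem n m p) (x : Vec n) (i : Fin m) : P.g i x ≤ P.infeas x :=
  le_maxViolation_left (fun i => P.g i x) (fun j => P.h j x) i

theorem abs_h_le_infeas (P : Problem n m p) (x : Vec n) (j : Fin p) : |P.h j x| ≤ P.infeas x :=
  le_maxViolation_right (fun i => P.g i x) (fun j => P.h j x) j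

/-- Duality between the `ℓ¹` norm of the multipliers and the max-type violation; this is why an `ℓ¹`
bound is the right penalty weight. -/
theorem lagr_le (A : Method n m) (P : Problem n m p) (κ : ℝ) {ξ : Fin m → ℝ} (π : Fin p → ℝ)
    (hξ : ∀ i, 0 ≤ ξ i) (d x : Vec n) :
    A.lagr P κ ξ π d x ≤ (A.viol P d x - κ) * (∑ i, ξ i + ∑ j, |π j|) := by
  rw [mul_add, Finset.mul_sum, Finset.mul_sum]
  refine add_le_add (Finset.sum_le_sum fun i _ => ?_) (Finset.sum_le_sum fun j _ => ?_)
  · rw [mul_comm]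
    exact mul_le_mul_of_nonneg_right (sub_le_sub_right (A.gt_le_viol P d x i) _) (hξ i)
  · have h1 : π j * ht P j d x ≤ A.viol P d x * |π j| := by
      calc π j * ht P j d x ≤ |π j * ht P j d x| := le_abs_self _
        _ = |ht P j d x| * |π j| := by rw [abs_mul, mul_comm]
        _ ≤ _ := mul_le_mul_of_nonneg_right (A.abs_ht_le_viol P d x j) (abs_nonneg _)
    linarith

theorem lagr_smul (A : Method n m) (P : Problem n m p) (κ : ℝ) (ξ : Fin m → ℝ) (π : Fin p → ℝ)
    (d x : Vec n) {s : ℝ} (hs : 0 ≤ s) :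
    A.lagr P κ (fun i => s * ξ i) (fun j => s * π j) d x = s * A.lagr P κ ξ π d x := by
  simp only [lagr, mul_add, Finset.mul_sum, abs_mul, abs_of_nonneg hs]
  congr 1 <;> exact Finset.sum_congr rfl fun _ _ => by ring

theorem ht_zero (P : Problem n m p) (j : Fin p) (x : Vec n) : ht P j 0 x = P.h j x := by
  simp [ht]

theorem exists_subseq_multipliers {M : ℝ} {ξ : ℕ → Fin m → ℝ} {π : ℕ → Fin p → ℝ}
    (hξ : ∀ k i, 0 ≤ ξ k i) (hM : ∀ k, ∑ i, ξ k i + ∑ j, |π k j| ≤ M) :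
    ∃ (ξ₀ : Fin m → ℝ) (π₀ : Fin p → ℝ) (s : ℕ → ℕ), StrictMono s ∧ (∀ i, 0 ≤ ξ₀ i) ∧
      (∀ i, Tendsto (fun k => ξ (s k) i) atTop (𝓝 (ξ₀ i))) ∧
      ∀ j, Tendsto (fun k => π (s k) j) atTop (𝓝 (π₀ j)) := by
  have hpos1 : ∀ k, 0 ≤ ∑ i, ξ k i := fun k => Finset.sum_nonneg fun i _ => hξ k i
  have hpos2 : ∀ k, 0 ≤ ∑ j, |π k j| := fun k => Finset.sum_nonneg fun i _ => abs_nonneg _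
  have hM0 : 0 ≤ M := by linarith [hpos1 0, hpos2 0, hM 0]
  have hmem : ∀ k, (ξ k, π k) ∈ Metric.closedBall (0 : (Fin m → ℝ) × (Fin p → ℝ)) M := fun k => by
    rw [mem_closedBall_zero_iff, norm_prod_le_iff, pi_norm_le_iff_of_nonneg hM0,
      pi_norm_le_iff_of_nonneg hM0]
    refine ⟨fun i => ?_, fun j => ?_⟩
    · rw [Real.norm_of_nonneg (hξ k i)]
      have := Finset.single_le_sum (fun i _ => hξ k i) (Finset.mem_univ i)
      linarith [hM k, hpos2 k]
    · rw [Real.norm_eq_abs]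
      have := Finset.single_le_sum (f := fun j => |π k j|) (fun j _ => abs_nonneg _)
        (Finset.mem_univ j)
      linarith [hM k, hpos1 k]
  obtain ⟨⟨ξ₀, π₀⟩, -, s, hs, hlim⟩ := (isCompact_closedBall _ _).tendsto_subseq hmem
  have h1 : ∀ i, Tendsto (fun k => ξ (s k) i) atTop (𝓝 (ξ₀ i)) :=
    tendsto_pi_nhds.1 ((continuous_fst.tendsto (ξ₀, π₀)).comp hlim)
  exact ⟨ξ₀, π₀, s, hs, fun i => ge_of_tendsto' (h1 i) fun k => hξ _ _, h1,
    tendsto_pi_nhds.1 ((continuous_snd.tendsto (ξ₀, π₀)).comp hlim)⟩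

namespace Regular

variable {A : Method n m} {P : Problem n m p} {c : ℝ}

theorem viol_zero (hR : A.Regular P c) {x : Vec n} (hx : x ∈ P.K) :
    A.viol P 0 x = P.infeas x := by
  simp only [viol, Problem.infeas, ht_zero, hR.gt_zero _ x hx]

theorem ht_continuousOn (hR : A.Regular P c) (j : Fin p) :
    ContinuousOn (fun z : Vec n × Vec n => ht P j z.1 z.2) (Set.univ ×ˢ P.K) := by
  have hmaps : Set.MapsTo (Prod.snd : Vec n × Vec n → Vec n) (Set.univ ×ˢ P.K) P.K :=
    fun z hz => hz.2
  exact ((hR.standing.h_smooth j).continuousOn.comp continuousOn_snd hmaps).add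
    (((hR.standing.h_smooth j).continuousOn_gradient.comp continuousOn_snd hmaps).inner
      continuousOn_fst)

theorem viol_continuousOn (hR : A.Regular P c) :
    ContinuousOn (fun z : Vec n × Vec n => A.viol P z.1 z.2) (Set.univ ×ˢ P.K) :=
  ContinuousOn.maxViolation hR.gt_continuousOn hR.ht_continuousOn

theorem q_continuousOn (hR : A.Regular P c) : ContinuousOn P.q P.K := by
  obtain ⟨U, -, hKU, hU⟩ := hR.standing.q_lipschitz
  exact hU.continuousOn.mono hKU

theorem infeas_continuousOn (hR : A.Regular P c) : ContinuousOn P.infeas P.K :=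
  ContinuousOn.maxViolation (fun i => (hR.standing.g_smooth i).continuousOn)
    fun j => (hR.standing.h_smooth j).continuousOn

theorem obj_continuousOn (hR : A.Regular P c) :
    ContinuousOn (fun z : Vec n × Vec n => A.obj P z.1 z.2)
      ((boxBall n A.β ×ˢ P.K) ∩ {z | z.2 + z.1 ∈ P.K}) :=
  (hR.ft_continuousOn.mono Set.inter_subset_left).add
    (hR.q_continuousOn.comp (by fun_prop) fun _ hz => hz.2)

/-- Sequential continuity on a set of pairs. -/
theorem tendsto_prod {F : Vec n × Vec n → ℝ} {S : Set (Vec n × Vec n)} (hF : ContinuousOn F S)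
    {y x : ℕ → Vec n} {y₀ x₀ : Vec n} (hy : Tendsto y atTop (𝓝 y₀)) (hx : Tendsto x atTop (𝓝 x₀))
    (h0 : (y₀, x₀) ∈ S) (h : ∀ᶠ k in atTop, (y k, x k) ∈ S) :
    Tendsto (fun k => F (y k, x k)) atTop (𝓝 (F (y₀, x₀))) :=
  (hF (y₀, x₀) h0).tendsto.comp (tendsto_nhdsWithin_iff.2 ⟨hy.prodMk_nhds hx, h⟩)

theorem exists_inner_minimizer (hR : A.Regular P c) {x : Vec n} (hx : x ∈ P.K) :
    ∃ y ∈ boxBall n A.ρ, x + y ∈ P.K ∧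
      A.kappa P x = (1 - A.lam) * P.infeas x + A.lam * A.viol P y x ∧
      ∀ z ∈ boxBall n A.ρ, x + z ∈ P.K → A.viol P y x ≤ A.viol P z x := by
  have hcl : IsClosed {d : Vec n | x + d ∈ P.K} :=
    hR.standing.K_closed.preimage (by fun_prop)
  have hcomp : IsCompact {d | d ∈ boxBall n A.ρ ∧ x + d ∈ P.K} :=
    (isCompact_boxBall _).inter_right hcl
  have hcont : ContinuousOn (fun d => A.viol P d x) {d | d ∈ boxBall n A.ρ ∧ x + d ∈ P.K} :=
    hR.viol_continuousOn.comp (f := fun d : Vec n => (d, x)) (by fun_prop)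
      fun d _ => ⟨Set.mem_univ _, hx⟩
  obtain ⟨y, hy, hmin⟩ := hcomp.exists_isMinOn
    ⟨0, zero_mem_boxBall hR.admissible.ρ_pos.le, by simpa using hx⟩ hcont
  refine ⟨y, hy.1, hy.2, ?_, fun z hz hxz => hmin ⟨hz, hxz⟩⟩
  rw [kappa]
  congr 2
  refine IsLeast.csInf_eq ⟨⟨y, hy, rfl⟩, ?_⟩
  rintro _ ⟨z, hz, rfl⟩
  exact hmin hz

theorem kappa_nonneg (hR : A.Regular P c) {x : Vec n} (hx : x ∈ P.K) : 0 ≤ A.kappa P x := by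
  obtain ⟨y, -, -, h, -⟩ := hR.exists_inner_minimizer hx
  rw [h]
  have h1 := hR.admissible.lam_pos
  have h2 := hR.admissible.lam_lt
  have h3 : 0 ≤ A.viol P y x := maxViolation_nonneg _ _
  have h4 : 0 ≤ P.infeas x := maxViolation_nonneg _ _
  have : 0 ≤ 1 - A.lam := by linarith
  positivity

theorem kappa_le_of_mem (hR : A.Regular P c) {x z : Vec n} (hx : x ∈ P.K)
    (hz : z ∈ boxBall n A.ρ) (hxz : x + z ∈ P.K) :
    A.kappa P x ≤ (1 - A.lam) * P.infeas x + A.lam * A.viol P z x := by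
  obtain ⟨y, -, -, h, hmin⟩ := hR.exists_inner_minimizer hx
  rw [h]
  have := mul_le_mul_of_nonneg_left (hmin z hz hxz) hR.admissible.lam_pos.le
  linarith

theorem kappa_le_infeas (hR : A.Regular P c) {x : Vec n} (hx : x ∈ P.K) :
    A.kappa P x ≤ P.infeas x := by
  have := hR.kappa_le_of_mem hx (zero_mem_boxBall hR.admissible.ρ_pos.le) (by simpa using hx)
  rw [hR.viol_zero hx] at this
  linarith

theorem mem_feasible_iff (hR : A.Regular P c) {x d : Vec n} (hx : x ∈ P.K) :
    d ∈ A.feasible P x ↔ A.viol P d x ≤ A.kappa P x ∧ d ∈ boxBall n A.β ∧ x + d ∈ P.K := by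
  have := hR.kappa_nonneg hx
  simp only [feasible, viol, maxViolation_le_iff, abs_le, Set.mem_ofPred_eq]
  tauto

/-- The subproblem has a solution, so the choice in `dir` is meaningful: its feasible set is
compact, and contains the inner minimizer because `κ` is a convex combination of `φ` and the minimal
violation and `ρ < β`. Only existence matters here. -/
theorem dir_solves (hR : A.Regular P c) {x : Vec n} (hx : x ∈ P.K) :
    A.Solves P x (A.dir P x) := by
  refine Classical.epsilon_spec (p := A.Solves P x) ?_
  have hset : A.feasible P x =
      boxBall n A.β ∩ {d | A.viol P d x ≤ A.kappa P x ∧ x + d ∈ P.K} := by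
    ext d
    rw [hR.mem_feasible_iff hx]
    simp only [Set.mem_inter_iff, Set.mem_ofPred_eq]
    tauto
  have hv : Continuous fun d => A.viol P d x := by
    rw [← continuousOn_univ]
    exact hR.viol_continuousOn.comp (f := fun d : Vec n => (d, x)) (by fun_prop)
      fun d _ => ⟨Set.mem_univ _, hx⟩
  have hcomp : IsCompact (A.feasible P x) := by
    rw [hset]
    exact (isCompact_boxBall _).inter_right ((isClosed_le hv continuous_const).inter
      (hR.standing.K_closed.preimage (by fun_prop)))
  have hcont : ContinuousOn (fun d => A.obj P d x) (A.feasible P x) :=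
    hR.obj_continuousOn.comp (f := fun d : Vec n => (d, x)) (by fun_prop) fun d hd => by
      obtain ⟨-, h2, h3⟩ := (hR.mem_feasible_iff hx).1 hd
      exact ⟨⟨h2, hx⟩, h3⟩
  have hne : (A.feasible P x).Nonempty := by
    obtain ⟨y, hy, hxy, h, hmin⟩ := hR.exists_inner_minimizer hx
    refine ⟨y, (hR.mem_feasible_iff hx).2 ⟨?_, boxBall_mono hR.admissible.ρ_lt.le hy, hxy⟩⟩
    have h1 := hmin 0 (zero_mem_boxBall hR.admissible.ρ_pos.le) (by simpa using hx)
    rw [hR.viol_zero hx] at h1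
    have h2 := mul_le_mul_of_nonneg_left h1 (sub_nonneg.2 hR.admissible.lam_lt.le)
    linarith
  obtain ⟨d, hd, hmin⟩ := hcomp.exists_isMinOn hne hcont
  exact ⟨d, hd, fun e he => hmin he⟩

theorem viol_dir_le (hR : A.Regular P c) {x : Vec n} (hx : x ∈ P.K) :
    A.viol P (A.dir P x) x ≤ A.kappa P x :=
  ((hR.mem_feasible_iff hx).1 (hR.dir_solves hx).1).1

theorem dir_mem_boxBall (hR : A.Regular P c) {x : Vec n} (hx : x ∈ P.K) :
    A.dir P x ∈ boxBall n A.β :=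
  ((hR.mem_feasible_iff hx).1 (hR.dir_solves hx).1).2.1

theorem add_dir_mem (hR : A.Regular P c) {x : Vec n} (hx : x ∈ P.K) :
    x + A.dir P x ∈ P.K :=
  ((hR.mem_feasible_iff hx).1 (hR.dir_solves hx).1).2.2

theorem convex_steps (hR : A.Regular P c) (x : Vec n) (r : ℝ) :
    Convex ℝ {d | d ∈ boxBall n r ∧ x + d ∈ P.K} := by
  refine (convex_boxBall r).inter ?_
  intro y hy z hz a b ha hb hab
  have := hR.standing.K_convex hy hz ha hb hab
  rw [smul_add, smul_add, add_add_add_comm, ← add_smul, hab, one_smul] at this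
  exact this

theorem ht_affine (P : Problem n m p) (j : Fin p) (x y z : Vec n) {a b : ℝ} (hab : a + b = 1) :
    ht P j (a • y + b • z) x = a * ht P j y x + b * ht P j z x := by
  obtain rfl : b = 1 - a := by linarith
  simp only [ht, inner_add_right, real_inner_smul_right]
  ring

/-- The box and `K - x` are kept as the abstract constraint set and receive no multipliers. Without
a constraint qualification `τ` may vanish. -/
theorem exists_fritzJohn (hR : A.Regular P c) {x : Vec n} (hx : x ∈ P.K) :
    ∃ (τ : ℝ) (ξ : Fin m → ℝ) (π : Fin p → ℝ), 0 ≤ τ ∧ (∀ i, 0 ≤ ξ i) ∧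
      τ + (∑ i, ξ i + ∑ j, |π j|) = 1 ∧
      ∀ d ∈ boxBall n A.β, x + d ∈ P.K →
        0 ≤ τ * (A.obj P d x - A.obj P (A.dir P x) x) + A.lagr P (A.kappa P x) ξ π d x := by
  have hY := hR.convex_steps x A.β
  have hθ : ConvexOn ℝ {d | d ∈ boxBall n A.β ∧ x + d ∈ P.K} fun d => A.obj P d x := by
    have h1 := ((hR.ft_strongConvex x hx).strictConvexOn hR.modulus_pos).convexOn
    refine (h1.subset (fun d hd => hd.1) hY).add ⟨hY, fun y hy z hz a b ha hb hab => ?_⟩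
    have := hR.standing.q_convex.2 (hR.standing.K_sub_D hy.2) (hR.standing.K_sub_D hz.2) ha hb hab
    convert this using 2
    rw [smul_add, smul_add, add_add_add_comm, ← add_smul, hab, one_smul]
  obtain ⟨τ, ξ, π, h1, h2, h3, h4⟩ := DSM.exists_fritzJohn
    (Y := {d | d ∈ boxBall n A.β ∧ x + d ∈ P.K})
    ⟨A.dir P x, hR.dir_mem_boxBall hx, hR.add_dir_mem hx⟩ hθ
    (G := fun i d => A.gt i d x) (fun i => (hR.gt_convex i x hx).subset (fun d hd => hd.1) hY)
    (H := fun j d => ht P j d x) (fun j y _ z _ a b _ _ hab => ht_affine P j x y z hab)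
    (θ₀ := A.obj P (A.dir P x) x) (hR.kappa_nonneg hx) (fun d hd hg hh =>
      (hR.dir_solves hx).2 d ⟨hg, fun j => abs_le.1 (hh j), hd.1, hd.2⟩)
  exact ⟨τ, ξ, π, h1, h2, h3, fun d hd hxd => h4 d ⟨hd, hxd⟩⟩

theorem tendsto_lagr (hR : A.Regular P c) {y x : ℕ → Vec n} {y₀ x₀ : Vec n} {κ : ℕ → ℝ} {κ₀ : ℝ}
    {ξ : ℕ → Fin m → ℝ} {π : ℕ → Fin p → ℝ} {ξ₀ : Fin m → ℝ} {π₀ : Fin p → ℝ}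
    (hy : Tendsto y atTop (𝓝 y₀)) (hx : Tendsto x atTop (𝓝 x₀)) (hxK : ∀ k, x k ∈ P.K)
    (hx₀ : x₀ ∈ P.K) (hκ : Tendsto κ atTop (𝓝 κ₀))
    (hξ : ∀ i, Tendsto (fun k => ξ k i) atTop (𝓝 (ξ₀ i)))
    (hπ : ∀ j, Tendsto (fun k => π k j) atTop (𝓝 (π₀ j))) :
    Tendsto (fun k => A.lagr P (κ k) (ξ k) (π k) (y k) (x k)) atTop
      (𝓝 (A.lagr P κ₀ ξ₀ π₀ y₀ x₀)) := by
  have h0 : (y₀, x₀) ∈ (Set.univ : Set (Vec n)) ×ˢ P.K := ⟨Set.mem_univ _, hx₀⟩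
  have h1 : ∀ᶠ k in atTop, (y k, x k) ∈ (Set.univ : Set (Vec n)) ×ˢ P.K :=
    Eventually.of_forall fun k => ⟨Set.mem_univ _, hxK k⟩
  refine (tendsto_finsetSum _ fun i _ => (hξ i).mul
    ((tendsto_prod (hR.gt_continuousOn i) hy hx h0 h1).sub hκ)).add
    (tendsto_finsetSum _ fun j _ => ((hπ j).mul
      (tendsto_prod (hR.ht_continuousOn j) hy hx h0 h1)).sub (hκ.mul (hπ j).abs))

theorem tendsto_infeas (hR : A.Regular P c) {x : ℕ → Vec n} {x₀ : Vec n}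
    (hx : Tendsto x atTop (𝓝 x₀)) (hxK : ∀ k, x k ∈ P.K) (hx₀ : x₀ ∈ P.K) :
    Tendsto (fun k => P.infeas (x k)) atTop (𝓝 (P.infeas x₀)) :=
  (hR.infeas_continuousOn x₀ hx₀).tendsto.comp
    (tendsto_nhdsWithin_iff.2 ⟨hx, Eventually.of_forall hxK⟩)

/-- The surrogates have the true gradients at `d = 0`; this is where stationarity of the subproblem
becomes stationarity of the original problem. -/
theorem lagr_hasDerivAt (hR : A.Regular P c) {x : Vec n} (hx : x ∈ P.K) (κ : ℝ) (ξ : Fin m → ℝ)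
    (π : Fin p → ℝ) (v : Vec n) :
    HasDerivAt (fun t : ℝ => A.lagr P κ ξ π (t • v) x)
      ⟪P.multSum x (WithLp.toLp 2 ξ) (WithLp.toLp 2 π), v⟫ 0 := by
  have e : ⟪P.multSum x (WithLp.toLp 2 ξ) (WithLp.toLp 2 π), v⟫ =
      ∑ i, ξ i * ⟪gradient (P.g i) x, v⟫ + ∑ j, π j * ⟪gradient (P.h j) x, v⟫ := by
    simp [Problem.multSum, inner_add_left, sum_inner, real_inner_smul_left]
  rw [e]
  refine HasDerivAt.fun_add (HasDerivAt.fun_sum fun i _ => ?_) (HasDerivAt.fun_sum fun j _ => ?_)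
  · have := HasGradientAt.hasDerivAt_line (hR.gt_gradient i x hx) v
    simp only [zero_add] at this
    exact (this.sub_const κ).const_mul (ξ i)
  · have h1 : HasDerivAt (fun t : ℝ => t * ⟪gradient (P.h j) x, v⟫) ⟪gradient (P.h j) x, v⟫ 0 := by
      simpa using (hasDerivAt_id (0 : ℝ)).mul_const ⟪gradient (P.h j) x, v⟫
    have h2 := ((h1.const_add (P.h j x)).const_mul (π j)).sub_const (κ * |π j|)
    simpa only [ht, real_inner_smul_right] using h2

/-- With `κ = φ(x)` every term of the Lagrangian at `d = 0` is nonpositive, so a nonnegative sum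
forces each term to vanish. These equalities are the normal cone conditions on the multipliers. -/
theorem complementarity (hR : A.Regular P c) {x : Vec n} (hx : x ∈ P.K) {ξ : Fin m → ℝ}
    {π : Fin p → ℝ} (hξ : ∀ i, 0 ≤ ξ i) (h : 0 ≤ A.lagr P (P.infeas x) ξ π 0 x) :
    A.lagr P (P.infeas x) ξ π 0 x = 0 ∧ (∀ i, ξ i * (P.g i x - P.infeas x) = 0) ∧
      ∀ j, π j * P.h j x = P.infeas x * |π j| := by
  have h1 : ∀ i ∈ Finset.univ, ξ i * (A.gt i 0 x - P.infeas x) ≤ 0 := fun i _ => by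
    refine mul_nonpos_of_nonneg_of_nonpos (hξ i) ?_
    rw [hR.gt_zero i x hx, sub_nonpos]
    exact g_le_infeas P x i
  have h2 : ∀ j ∈ Finset.univ, π j * ht P j 0 x - P.infeas x * |π j| ≤ 0 := fun j _ => by
    rw [ht_zero, sub_nonpos]
    calc π j * P.h j x ≤ |π j * P.h j x| := le_abs_self _
      _ = |P.h j x| * |π j| := by rw [abs_mul, mul_comm]
      _ ≤ _ := mul_le_mul_of_nonneg_right (abs_h_le_infeas P x j) (abs_nonneg _)
  have s1 := Finset.sum_nonpos h1
  have s2 := Finset.sum_nonpos h2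
  rw [lagr] at h
  have e1 : ∑ i, ξ i * (A.gt i 0 x - P.infeas x) = 0 := by linarith
  have e2 : ∑ j, (π j * ht P j 0 x - P.infeas x * |π j|) = 0 := by linarith
  refine ⟨by rw [lagr, e1, e2, add_zero], fun i => ?_, fun j => ?_⟩
  · rw [← hR.gt_zero i x hx]
    exact (Finset.sum_eq_zero_iff_of_nonpos h1).1 e1 i (Finset.mem_univ i)
  · have := (Finset.sum_eq_zero_iff_of_nonpos h2).1 e2 j (Finset.mem_univ j)
    rw [ht_zero] at this
    linarith

/-- A test step `y` at the limit is transported to `x k` so that the landing point `x₀ + y` never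
moves and stays in `K`. The transported step is eventually in the box when `y` is strictly inside
it. -/
theorem tendsto_shift {x : ℕ → Vec n} {x₀ : Vec n} (hx : Tendsto x atTop (𝓝 x₀)) (y : Vec n) :
    Tendsto (fun k => x₀ + y - x k) atTop (𝓝 y) := by
  simpa using (tendsto_const_nhds (x := x₀ + y)).sub hx

/-- Abnormal approximate multipliers along a sequence produce an abnormal multiplier at the
limit. -/
theorem M0_ne_of_tendsto (hR : A.Regular P c) {r : ℝ} (hr : 0 < r) {x : ℕ → Vec n} {x₀ : Vec n}
    (hx : Tendsto x atTop (𝓝 x₀)) (hxK : ∀ k, x k ∈ P.K) (hx₀ : x₀ ∈ P.K)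
    {κ : ℕ → ℝ} (hκ : Tendsto κ atTop (𝓝 (P.infeas x₀)))
    {ξ : ℕ → Fin m → ℝ} {π : ℕ → Fin p → ℝ} (hξ : ∀ k i, 0 ≤ ξ k i)
    (hle : ∀ k, ∑ i, ξ k i + ∑ j, |π k j| ≤ 1)
    (hone : Tendsto (fun k => ∑ i, ξ k i + ∑ j, |π k j|) atTop (𝓝 1))
    {ε : ℕ → ℝ} (hε : Tendsto ε atTop (𝓝 0))
    (h : ∀ k, ∀ d ∈ boxBall n r, x k + d ∈ P.K → -ε k ≤ A.lagr P (κ k) (ξ k) (π k) d (x k)) :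
    P.M0 x₀ ≠ {0} := by
  obtain ⟨ξ₀, π₀, s, hs, hξ₀, hξlim, hπlim⟩ := exists_subseq_multipliers hξ hle
  have hst := hs.tendsto_atTop
  have hlim : ∀ d : Vec n, (∀ i, |d i| < r) → x₀ + d ∈ P.K →
      0 ≤ A.lagr P (P.infeas x₀) ξ₀ π₀ d x₀ := by
    intro d hd hdK
    have h1 := tendsto_shift (hx.comp hst) d
    have h2 := hR.tendsto_lagr h1 (hx.comp hst) (fun k => hxK _) hx₀ (hκ.comp hst) hξlim hπlim
    refine ge_of_tendsto ((h2.add (hε.comp hst)).trans_eq (by rw [add_zero])) ?_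
    filter_upwards [h1.eventually ((isOpen_openBox r).mem_nhds hd)] with k hk
    have := h (s k) (x₀ + d - x (s k)) (fun i => (hk i).le) (by simpa using hdK)
    simp only [Function.comp_apply]
    linarith
  have h0 := hlim 0 (fun i => by simpa using hr) (by simpa using hx₀)
  obtain ⟨e0, e1, e2⟩ := hR.complementarity hx₀ hξ₀ h0
  have hmem : ((WithLp.toLp 2 ξ₀, WithLp.toLp 2 π₀) : Vec m × Vec p) ∈ P.M0 x₀ := by
    refine ⟨mem_normalCone_nonposOrthant
        (fun i => sub_nonpos.2 (g_le_infeas P x₀ i)) hξ₀ e1,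
      mem_normalCone_boxBall (fun j => abs_h_le_infeas P x₀ j) e2,
      -P.multSum x₀ (WithLp.toLp 2 ξ₀) (WithLp.toLp 2 π₀), ⟨hx₀, fun z hz => ?_⟩,
      add_neg_cancel _⟩
    rw [inner_neg_left, neg_nonpos]
    refine deriv_nonneg_of_eventually_nonneg (hR.lagr_hasDerivAt hx₀ (P.infeas x₀) ξ₀ π₀ (z - x₀))
      (by simpa using e0) ?_
    have h1 : ∀ᶠ t in 𝓝[>] (0 : ℝ), t < 1 := nhdsWithin_le_nhds (Iio_mem_nhds one_pos)
    filter_upwards [eventually_smul_mem_openBox hr (z - x₀), h1, self_mem_nhdsWithin]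
      with t ht ht1 ht0
    refine hlim _ ht ?_
    have ht0' : (0 : ℝ) < t := ht0
    exact hR.standing.K_convex.add_smul_sub_mem hx₀ hz ⟨ht0'.le, ht1.le⟩
  intro hM
  rw [hM] at hmem
  have hz : ((WithLp.toLp 2 ξ₀, WithLp.toLp 2 π₀) : Vec m × Vec p) = 0 := hmem
  have z1 : ∀ i, ξ₀ i = 0 := fun i => by
    have := congrArg (fun w : Vec m × Vec p => w.1 i) hz
    simpa using this
  have z2 : ∀ j, π₀ j = 0 := fun j => by
    have := congrArg (fun w : Vec m × Vec p => w.2 j) hz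
    simpa using this
  -- The limit multipliers inherit total mass `1`, so they cannot vanish.
  have hsum : Tendsto (fun k => ∑ i, ξ (s k) i + ∑ j, |π (s k) j|) atTop
      (𝓝 (∑ i, ξ₀ i + ∑ j, |π₀ j|)) :=
    (tendsto_finsetSum _ fun i _ => hξlim i).add (tendsto_finsetSum _ fun j _ => (hπlim j).abs)
  have := tendsto_nhds_unique hsum (hone.comp hst)
  simp [z1, z2] at this

theorem exists_obj_bound (hR : A.Regular P c) {T : Set (Vec n)} (hT : IsCompact T)
    (hTK : T ⊆ P.K) :
    ∃ Q : ℝ, ∀ x ∈ T, ∀ d ∈ boxBall n A.β, x + d ∈ P.K → |A.obj P d x| ≤ Q := by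
  have hcomp : IsCompact ((boxBall n A.β ×ˢ T) ∩ {z : Vec n × Vec n | z.2 + z.1 ∈ P.K}) :=
    ((isCompact_boxBall _).prod hT).inter_right (hR.standing.K_closed.preimage (by fun_prop))
  obtain ⟨Q, hQ⟩ := hcomp.exists_bound_of_continuousOn (hR.obj_continuousOn.mono
    (Set.inter_subset_inter_left _ (Set.prod_mono le_rfl hTK)))
  exact ⟨Q, fun x hx d hd hxd => hQ (d, x) ⟨⟨hd, hx⟩, hxd⟩⟩

/-- Near a point where the eMFCQ holds the multipliers of the subproblems exist and are
uniformly bounded. -/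
theorem exists_eventually_hasMultipliers (hR : A.Regular P c) {x₀ : Vec n} (h : P.EMFCQ x₀) :
    ∃ M, ∀ᶠ x in 𝓝[P.K] x₀, A.HasMultipliers P M x := by
  obtain ⟨hx₀, hM0⟩ := h
  by_contra hcon
  push Not at hcon
  have hseq : ∀ k : ℕ, ∃ x ∈ P.K, dist x x₀ < 1 / ((k : ℝ) + 1) ∧
      ¬ A.HasMultipliers P ((k : ℝ) + 1) x := fun k => by
    have h1 : ∀ᶠ x in 𝓝[P.K] x₀, dist x x₀ < 1 / ((k : ℝ) + 1) :=
      nhdsWithin_le_nhds (Metric.ball_mem_nhds x₀ Nat.one_div_pos_of_nat)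
    obtain ⟨x, hx, hx1, hx2⟩ :=
      ((hcon ((k : ℝ) + 1)).and_eventually (h1.and self_mem_nhdsWithin)).exists
    exact ⟨x, hx2, hx1, hx⟩
  choose x hxK hxd hxM using hseq
  have hlim0 := tendsto_one_div_add_atTop_nhds_zero_nat (𝕜 := ℝ)
  have hx : Tendsto x atTop (𝓝 x₀) := by
    rw [tendsto_iff_dist_tendsto_zero]
    exact squeeze_zero (fun _ => dist_nonneg) (fun k => (hxd k).le) hlim0
  choose τ ξ π hτ hξ hsum hFJ using fun k => hR.exists_fritzJohn (hxK k)
  -- A larger `τ k` could be divided out, giving multipliers of norm at most `1 / τ k ≤ k + 1`,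
  -- against the choice of `x k`.
  have hτle : ∀ k : ℕ, τ k ≤ 1 / ((k : ℝ) + 1) := fun k => by
    by_contra hgt
    push Not at hgt
    have hk : (0 : ℝ) < 1 / ((k : ℝ) + 1) := Nat.one_div_pos_of_nat
    have hτ0 : 0 < τ k := hk.trans hgt
    have hinv : (τ k)⁻¹ ≤ (k : ℝ) + 1 := by
      rw [inv_le_comm₀ hτ0 (by positivity), ← one_div]
      exact hgt.le
    refine hxM k ⟨fun i => (τ k)⁻¹ * ξ k i, fun j => (τ k)⁻¹ * π k j,
      fun i => mul_nonneg (inv_nonneg.2 hτ0.le) (hξ k i), ?_, fun d hd hxd => ?_⟩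
    · simp only [abs_mul, abs_of_pos (inv_pos.2 hτ0), ← Finset.mul_sum, ← mul_add]
      have : ∑ i, ξ k i + ∑ j, |π k j| ≤ 1 := by linarith [hsum k]
      calc _ ≤ (τ k)⁻¹ * 1 := by gcongr
        _ ≤ _ := by rwa [mul_one]
    · rw [lagr_smul _ _ _ _ _ _ _ (inv_nonneg.2 hτ0.le)]
      have := mul_nonneg (inv_nonneg.2 hτ0.le) (hFJ k d hd hxd)
      rwa [mul_add, inv_mul_cancel_left₀ hτ0.ne'] at this
  have hτlim : Tendsto τ atTop (𝓝 0) := squeeze_zero hτ hτle hlim0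
  obtain ⟨Q, hQ⟩ := hR.exists_obj_bound hx.isCompact_insert_range
    (Set.insert_subset hx₀ (Set.range_subset_iff.2 hxK))
  have hε : Tendsto (fun k => τ k * (2 * Q)) atTop (𝓝 0) := by
    simpa using hτlim.mul_const (2 * Q)
  have hlagr : ∀ k, ∀ d ∈ boxBall n A.β, x k + d ∈ P.K →
      -(τ k * (2 * Q)) ≤ A.lagr P (A.kappa P (x k)) (ξ k) (π k) d (x k) := by
    intro k d hd hxd
    have hT : x k ∈ insert x₀ (Set.range x) := Set.mem_insert_of_mem _ ⟨k, rfl⟩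
    have h1 := abs_le.1 (hQ (x k) hT d hd hxd)
    have h2 := abs_le.1 (hQ (x k) hT _ (hR.dir_mem_boxBall (hxK k)) (hR.add_dir_mem (hxK k)))
    have h3 : A.obj P d (x k) - A.obj P (A.dir P (x k)) (x k) ≤ 2 * Q := by linarith
    have h4 := mul_le_mul_of_nonneg_left h3 (hτ k)
    have h5 := hFJ k d hd hxd
    linarith
  have hρβ := boxBall_mono (n := n) hR.admissible.ρ_lt.le
  have hl := hR.admissible.lam_pos
  have hl1 : 0 < 1 - A.lam := sub_pos.2 hR.admissible.lam_lt
  -- Test with the inner minimizer `y`, whose violation lies `u` below `φ`. There the Lagrangian is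
  -- at most `-(1 - lam) u (1 - τ)` and at least `-2Qτ`, so `u`, and with it the gap `lam * u`, is
  -- of order `τ`. The bound `τ < 1/2` only fixes a constant.
  have hgap : Tendsto (fun k => P.infeas (x k) - A.kappa P (x k)) atTop (𝓝 0) := by
    refine squeeze_zero' (Eventually.of_forall fun k => sub_nonneg.2 (hR.kappa_le_infeas (hxK k)))
      ?_ (g := fun k => 2 / (1 - A.lam) * (τ k * (2 * Q))) (by simpa using hε.const_mul _)
    filter_upwards [hτlim.eventually (Iio_mem_nhds (by norm_num : (0 : ℝ) < 1 / 2))] with k hk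
    obtain ⟨y, hy, hxy, hκ, hmin⟩ := hR.exists_inner_minimizer (hxK k)
    have h0 := hmin 0 (zero_mem_boxBall hR.admissible.ρ_pos.le) (by simpa using hxK k)
    rw [hR.viol_zero (hxK k)] at h0
    have h1 := (hlagr k y (hρβ hy) hxy).trans (A.lagr_le P _ (π k) (hξ k) y (x k))
    have h2 : ∑ i, ξ k i + ∑ j, |π k j| = 1 - τ k := by linarith [hsum k]
    rw [h2] at h1
    set u := P.infeas (x k) - A.viol P y (x k) with hu
    have hu0 : 0 ≤ u := sub_nonneg.2 h0
    have h3 : A.viol P y (x k) - A.kappa P (x k) = -((1 - A.lam) * u) := by rw [hκ]; ring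
    have h4 : P.infeas (x k) - A.kappa P (x k) = A.lam * u := by rw [hκ]; ring
    rw [h3] at h1
    have hk' : τ k < 1 / 2 := hk
    have h5 : (1 - A.lam) * u * (1 / 2) ≤ τ k * (2 * Q) := by
      have := mul_nonneg hl1.le hu0
      nlinarith
    rw [h4]
    have h6 : A.lam * u ≤ u := by
      have := hR.admissible.lam_lt
      nlinarith
    refine h6.trans ?_
    rw [div_mul_eq_mul_div, le_div_iff₀ hl1]
    linarith
  have hκ : Tendsto (fun k => A.kappa P (x k)) atTop (𝓝 (P.infeas x₀)) := by
    have := (hR.tendsto_infeas hx hxK hx₀).sub hgap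
    simpa using this
  refine hR.M0_ne_of_tendsto hR.admissible.ρ_pos hx hxK hx₀ hκ hξ (fun k => ?_) ?_ hε
    (fun k d hd hxd => hlagr k d (hρβ hd) hxd) hM0
  · linarith [hsum k, hτ k]
  · have : (fun k => ∑ i, ξ k i + ∑ j, |π k j|) = fun k => 1 - τ k := by
      ext k; linarith [hsum k]
    rw [this]
    simpa using hτlim.const_sub 1

end Regular

end Method

/-! ### Sequences with summable decrease -/

theorem summable_of_eventually_decrease {w b : ℕ → ℝ} {ℓ C : ℝ} (hC : 0 < C) (hb : ∀ ν, 0 ≤ b ν)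
    (hw : ∀ ν, ℓ ≤ w ν) (hdec : ∀ᶠ ν in atTop, w (ν + 1) ≤ w ν - C * b ν) : Summable b := by
  obtain ⟨N, hN⟩ := eventually_atTop.1 hdec
  rw [← summable_nat_add_iff N]
  refine summable_of_sum_range_le (c := (w N - ℓ) / C) (fun _ => hb _) fun k => ?_
  have key : C * ∑ i ∈ Finset.range k, b (i + N) ≤ w N - w (k + N) := by
    induction k with
    | zero => simp
    | succ k ih =>
      have h1 := hN (k + N) (Nat.le_add_left _ _)
      rw [Finset.sum_range_succ, mul_add, Nat.add_right_comm k 1 N]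
      linarith
  rw [le_div_iff₀ hC, mul_comm]
  linarith [hw (k + N)]

theorem frequently_lt_of_summable {γ a : ℕ → ℝ} (hγ : Method.IsStepsize γ)
    (hs : Summable fun ν => γ ν * a ν ^ 2) {δ : ℝ} (hδ : 0 < δ) : ∃ᶠ ν in atTop, a ν < δ := by
  intro hcon
  obtain ⟨N, hN⟩ := eventually_atTop.1 hcon
  have h1 : Summable fun ν => γ (ν + N) * δ ^ 2 := by
    refine Summable.of_nonneg_of_le (fun ν => mul_nonneg (hγ.pos _).le (sq_nonneg _))
      (fun ν => ?_) ((summable_nat_add_iff N).2 hs)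
    have h2 : δ ≤ a (ν + N) := not_lt.1 (hN (ν + N) (Nat.le_add_left _ _))
    exact mul_le_mul_of_nonneg_left (pow_le_pow_left₀ hδ.le h2 2) (hγ.pos _).le
  have h2 : Summable γ :=
    (summable_nat_add_iff N).1 ((summable_mul_right_iff (pow_pos hδ 2).ne').1 h1)
  exact not_tendsto_atTop_of_tendsto_nhds h2.hasSum.tendsto_sum_nat hγ.sum_diverges

/-- If `a` exceeds `ε` at a late index, follow the path until `a` drops below `ε / 2`. Until then `a
≥ ε / 2`, so the length travelled is at most `2 / ε` times a small tail of `∑ γ a²`. The endpoints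
are thus too close for `a` to have changed by `ε / 2`. -/
theorem tendsto_zero_of_summable {X : Type*} [PseudoMetricSpace X] {γ a : ℕ → ℝ} {x : ℕ → X}
    (hγ : Method.IsStepsize γ) (ha : ∀ ν, 0 ≤ a ν) (hs : Summable fun ν => γ ν * a ν ^ 2)
    (hx : ∀ ν, dist (x ν) (x (ν + 1)) ≤ γ ν * a ν)
    (huc : ∀ δ > 0, ∃ η > 0, ∀ μ ν, dist (x μ) (x ν) < η → |a μ - a ν| < δ) :
    Tendsto a atTop (𝓝 0) := by
  rw [Metric.tendsto_atTop]
  intro ε hε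
  obtain ⟨η, hη, huc⟩ := huc (ε / 2) (half_pos hε)
  obtain ⟨N, hN⟩ := Metric.cauchySeq_iff.1 hs.hasSum.tendsto_sum_nat.cauchySeq (ε / 2 * η)
    (by positivity)
  refine ⟨N, fun ν hν => ?_⟩
  rw [Real.dist_eq, sub_zero, abs_of_nonneg (ha ν)]
  by_contra hge
  push Not at hge
  have hex : ∃ k, ν ≤ k ∧ a k < ε / 2 :=
    frequently_atTop.1 (frequently_lt_of_summable hγ hs (half_pos hε)) ν
  classical
  obtain ⟨h1, h2⟩ := Nat.find_spec hex
  set ν' := Nat.find hex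
  have hbig : ∀ k ∈ Finset.Ico ν ν', ε / 2 ≤ a k := fun k hk => by
    rw [Finset.mem_Ico] at hk
    by_contra hlt
    exact Nat.find_min hex hk.2 ⟨hk.1, not_le.1 hlt⟩
  have hsum : ∑ k ∈ Finset.Ico ν ν', γ k * a k ^ 2 < ε / 2 * η := by
    rw [Finset.sum_Ico_eq_sub _ h1]
    have := hN ν' (hν.trans h1) ν hν
    rw [Real.dist_eq] at this
    exact (le_abs_self _).trans_lt this
  have hmove : ε / 2 * dist (x ν) (x ν') ≤ ∑ k ∈ Finset.Ico ν ν', γ k * a k ^ 2 := by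
    calc ε / 2 * dist (x ν) (x ν')
        ≤ ε / 2 * ∑ k ∈ Finset.Ico ν ν', dist (x k) (x (k + 1)) := by
          gcongr; exact dist_le_Ico_sum_dist x h1
      _ = ∑ k ∈ Finset.Ico ν ν', ε / 2 * dist (x k) (x (k + 1)) := Finset.mul_sum _ _ _
      _ ≤ _ := Finset.sum_le_sum fun k hk => by
          calc ε / 2 * dist (x k) (x (k + 1)) ≤ a k * (γ k * a k) :=
                mul_le_mul (hbig k hk) (hx k) dist_nonneg (ha k)
            _ = _ := by ring
  have hd : dist (x ν) (x ν') < η := lt_of_mul_lt_mul_left (hmove.trans_lt hsum) (half_pos hε).le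
  have := (abs_lt.1 (huc ν ν' hd)).2
  linarith

/-! ### Generalized stationarity and the eMFCQ -/

namespace Problem

variable {n m p : ℕ}

theorem isGenStationary_of_not_EMFCQ {P : Problem n m p} {x : Vec n} (hx : x ∈ P.K)
    (h : ¬ P.EMFCQ x) : P.IsGenStationary x := by
  have hM : P.M0 x ≠ {0} := fun e => h ⟨hx, e⟩
  by_cases hc : P.SatisfiesConstraints x
  · exact Or.inr (Or.inl ⟨hx, hc, hM⟩)
  · refine Or.inr (Or.inr ⟨hx, ?_, hM⟩)
    rw [SatisfiesConstraints, not_and_or] at hc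
    push Not at hc
    exact hc

theorem IsGenStationary.isKKT {P : Problem n m p} {x : Vec n} (h : P.IsGenStationary x)
    (hx : P.EMFCQ x) : P.IsKKT x := by
  rcases h with h | h | h
  · exact h
  · exact absurd hx.2 h.2.2
  · exact absurd hx.2 h.2.2

end Problem

/-! ### Limit points with vanishing direction, and descent of the merit function -/

namespace Method

namespace Regular

variable {n m p : ℕ} {A : Method n m} {P : Problem n m p} {c : ℝ}

/-- At a point where the eMFCQ holds, the subproblems can only fail to reduce the violation if
the point satisfies the constraints. -/
theorem infeas_eq_zero_of_tendsto (hR : A.Regular P c) {x₀ : Vec n} (h : P.EMFCQ x₀)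
    {x : ℕ → Vec n} (hx : Tendsto x atTop (𝓝 x₀)) (hxK : ∀ k, x k ∈ P.K)
    (hκ : Tendsto (fun k => A.kappa P (x k)) atTop (𝓝 (P.infeas x₀))) : P.infeas x₀ = 0 := by
  obtain ⟨hx₀, hM0⟩ := h
  by_contra hne
  set φ := P.infeas x₀ with hφ
  have hφ0 : 0 < φ := lt_of_le_of_ne (maxViolation_nonneg _ _) (Ne.symm hne)
  have hρ := hR.admissible.ρ_pos
  -- Since `κ → φ`, no step can reduce the violation at `x₀`. The radius `ρ / 2` keeps `d` strictly
  -- inside the box of radius `ρ`.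
  have hmin : ∀ d ∈ boxBall n (A.ρ / 2), x₀ + d ∈ P.K → φ ≤ A.viol P d x₀ := by
    intro d hd hdK
    have h1 := tendsto_shift hx d
    have h2 := tendsto_prod hR.viol_continuousOn h1 hx ⟨Set.mem_univ _, hx₀⟩
      (Eventually.of_forall fun k => ⟨Set.mem_univ _, hxK k⟩)
    have h3 := le_of_tendsto_of_tendsto hκ
      (((hR.tendsto_infeas hx hxK hx₀).const_mul (1 - A.lam)).add (h2.const_mul A.lam)) (by
        have hd' : ∀ i, |d i| < A.ρ := fun i => (hd i).trans_lt (half_lt_self hρ)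
        filter_upwards [h1.eventually ((isOpen_openBox A.ρ).mem_nhds hd')] with k hk
        exact hR.kappa_le_of_mem (hxK k) (fun i => (hk i).le) (by simpa using hdK))
    have h4 : 0 ≤ A.lam * (A.viol P d x₀ - φ) := by linarith
    exact sub_nonneg.1 (nonneg_of_mul_nonneg_right h4 hR.admissible.lam_pos)
  have hY := hR.convex_steps x₀ (A.ρ / 2)
  have h0mem : (0 : Vec n) ∈ {d | d ∈ boxBall n (A.ρ / 2) ∧ x₀ + d ∈ P.K} :=
    ⟨zero_mem_boxBall (half_pos hρ).le, by simpa using hx₀⟩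
  -- Any level below `φ` makes the system infeasible, so the optimality hypothesis of the
  -- alternative is vacuous and `θ₀` is free. With `θ = 0` and `θ₀ = k + 1`, evaluation at `d = 0`
  -- gives `τ k * (k + 1) ≤ φ`, hence `τ → 0`, while the levels increase to `φ`.
  let κ : ℕ → ℝ := fun k => φ - φ * (1 / ((k : ℝ) + 1))
  have hone : ∀ k : ℕ, 0 < 1 / ((k : ℝ) + 1) := fun k => Nat.one_div_pos_of_nat
  have hone' : ∀ k : ℕ, 1 / ((k : ℝ) + 1) ≤ 1 := fun k => by
    rw [div_le_one (by positivity)]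
    have : (0 : ℝ) ≤ k := k.cast_nonneg
    linarith
  have hlim0 := tendsto_one_div_add_atTop_nhds_zero_nat (𝕜 := ℝ)
  have hκlim : Tendsto κ atTop (𝓝 φ) := by
    simpa only [mul_zero, sub_zero] using (hlim0.const_mul φ).const_sub φ
  have hκ0 : ∀ k, 0 ≤ κ k := fun k => by
    have := mul_le_mul_of_nonneg_left (hone' k) hφ0.le
    simp only [κ]
    linarith
  have hκlt : ∀ k, κ k < φ := fun k => by
    have := mul_pos hφ0 (hone k)
    simp only [κ]
    linarith
  have hFJ := fun k : ℕ => DSM.exists_fritzJohn ⟨0, h0mem⟩ (θ := fun _ => 0) (convexOn_const 0 hY)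
    (G := fun i d => A.gt i d x₀)
    (fun i => (hR.gt_convex i x₀ hx₀).subset
      (fun d hd => boxBall_mono (by linarith [hR.admissible.ρ_lt]) hd.1) hY)
    (H := fun j d => ht P j d x₀) (fun j y _ z _ a b _ _ hab => ht_affine P j x₀ y z hab)
    (θ₀ := (k : ℝ) + 1) (hκ0 k) (fun d hd hg hh => by
      have h1 : A.viol P d x₀ ≤ κ k := maxViolation_le_iff.2 ⟨hκ0 k, hg, hh⟩
      exact absurd (h1.trans_lt (hκlt k)) (not_lt.2 (hmin d hd.1 hd.2)))
  choose τ ξ π hτ hξ hsum hL using hFJ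
  have hL' : ∀ k, ∀ d ∈ boxBall n (A.ρ / 2), x₀ + d ∈ P.K →
      τ k * ((k : ℝ) + 1) ≤ A.lagr P (κ k) (ξ k) (π k) d x₀ := fun k d hd hdK => by
    have h1 : 0 ≤ τ k * (0 - ((k : ℝ) + 1)) + A.lagr P (κ k) (ξ k) (π k) d x₀ :=
      hL k d ⟨hd, hdK⟩
    linarith
  have hτle : ∀ k : ℕ, τ k ≤ φ * (1 / ((k : ℝ) + 1)) := fun k => by
    have h1 := (hL' k 0 h0mem.1 h0mem.2).trans (A.lagr_le P _ (π k) (hξ k) 0 x₀)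
    rw [hR.viol_zero hx₀] at h1
    have h2 : (P.infeas x₀ - κ k) * (∑ i, ξ k i + ∑ j, |π k j|) ≤ φ * 1 := by
      refine mul_le_mul (by linarith [hκ0 k]) (by linarith [hsum k, hτ k]) ?_ hφ0.le
      exact add_nonneg (Finset.sum_nonneg fun i _ => hξ k i)
        (Finset.sum_nonneg fun j _ => abs_nonneg _)
    rw [mul_one_div, le_div_iff₀ (by positivity)]
    linarith
  have hτlim : Tendsto τ atTop (𝓝 0) :=
    squeeze_zero hτ hτle (by simpa using hlim0.const_mul φ)
  refine hR.M0_ne_of_tendsto (half_pos hρ) (x := fun _ => x₀) (π := π) tendsto_const_nhds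
    (fun _ => hx₀)
    hx₀ hκlim hξ (fun k => ?_) ?_ (ε := fun _ => 0) tendsto_const_nhds (fun k d hd hdK => ?_) hM0
  · linarith [hsum k, hτ k]
  · have : (fun k => ∑ i, ξ k i + ∑ j, |π k j|) = fun k => 1 - τ k := by
      ext k; linarith [hsum k]
    rw [this]
    simpa using hτlim.const_sub 1
  · have := mul_nonneg (hτ k) (by positivity : (0 : ℝ) ≤ (k : ℝ) + 1)
    have := hL' k d hd hdK
    simp only [neg_zero]
    linarith

theorem isKKT_of_tendsto_of_multipliers (hR : A.Regular P c) {x₀ : Vec n} (h : P.EMFCQ x₀)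
    {x : ℕ → Vec n} (hx : Tendsto x atTop (𝓝 x₀)) (hxK : ∀ k, x k ∈ P.K)
    (hd : Tendsto (fun k => A.dir P (x k)) atTop (𝓝 0)) {M : ℝ}
    (hM : ∀ k, A.HasMultipliers P M (x k)) : P.IsKKT x₀ := by
  have hx₀ := h.1
  have hβ := hR.admissible.β_pos
  -- `κ` lies between the violation of the step `d(x k)` and `φ(x k)`, which have the same limit
  -- because `d(x k) → 0`.
  have hκ : Tendsto (fun k => A.kappa P (x k)) atTop (𝓝 (P.infeas x₀)) := by
    have h1 := tendsto_prod hR.viol_continuousOn hd hx ⟨Set.mem_univ _, hx₀⟩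
      (Eventually.of_forall fun k => ⟨Set.mem_univ _, hxK k⟩)
    simp only [hR.viol_zero hx₀] at h1
    exact tendsto_of_tendsto_of_tendsto_of_le_of_le h1 (hR.tendsto_infeas hx hxK hx₀)
      (fun k => hR.viol_dir_le (hxK k)) fun k => hR.kappa_le_infeas (hxK k)
  have hφ := hR.infeas_eq_zero_of_tendsto h hx hxK hκ
  have hg : ∀ i, P.g i x₀ ≤ 0 := fun i => hφ ▸ g_le_infeas P x₀ i
  have hh : ∀ j, P.h j x₀ = 0 := fun j =>
    abs_eq_zero.1 (le_antisymm (hφ ▸ abs_h_le_infeas P x₀ j) (abs_nonneg _))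
  refine ⟨hx₀, ⟨hg, hh⟩, ?_⟩
  choose ξ π hξ hle hL using hM
  obtain ⟨ξ₀, π₀, s, hs, hξ₀, hξlim, hπlim⟩ := exists_subseq_multipliers hξ hle
  have hst := hs.tendsto_atTop
  have hxs := hx.comp hst
  have hlim : ∀ d : Vec n, (∀ i, |d i| < A.β) → x₀ + d ∈ P.K →
      0 ≤ A.obj P d x₀ - A.obj P 0 x₀ + A.lagr P (P.infeas x₀) ξ₀ π₀ d x₀ := by
    intro d hdβ hdK
    have h1 := tendsto_shift hxs d
    have hev := h1.eventually ((isOpen_openBox A.β).mem_nhds hdβ)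
    have h2 := hR.tendsto_lagr h1 hxs (fun k => hxK _) hx₀ (hκ.comp hst) hξlim hπlim
    have h3 := tendsto_prod hR.obj_continuousOn h1 hxs ⟨⟨fun i => (hdβ i).le, hx₀⟩, hdK⟩ (by
      filter_upwards [hev] with k hk
      refine ⟨⟨fun i => (hk i).le, hxK _⟩, ?_⟩
      simpa using hdK)
    have h4 := tendsto_prod hR.obj_continuousOn (hd.comp hst) hxs
      ⟨⟨zero_mem_boxBall hβ.le, hx₀⟩, by simpa using hx₀⟩
      (Eventually.of_forall fun k => ⟨⟨hR.dir_mem_boxBall (hxK _), hxK _⟩, hR.add_dir_mem (hxK _)⟩)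
    refine ge_of_tendsto ((h3.sub h4).add h2) ?_
    filter_upwards [hev] with k hk
    exact hL (s k) (x₀ + d - x (s k)) (fun i => (hk i).le) (by simpa using hdK)
  have h0 := hlim 0 (fun i => by simpa using hβ) (by simpa using hx₀)
  rw [sub_self, zero_add] at h0
  obtain ⟨e0, e1, e2⟩ := hR.complementarity hx₀ hξ₀ h0
  set a := gradient P.f x₀ + P.multSum x₀ (WithLp.toLp 2 ξ₀) (WithLp.toLp 2 π₀) with ha
  have hmin : ∀ z ∈ P.K, P.q x₀ ≤ P.q z + ⟪a, z - x₀⟫ := by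
    intro z hz
    have d1 := HasGradientAt.hasDerivAt_line (hR.ft_gradient x₀ hx₀) (z - x₀)
    simp only [zero_add] at d1
    have d2 := hR.lagr_hasDerivAt hx₀ (P.infeas x₀) ξ₀ π₀ (z - x₀)
    -- The increment of `q` along the segment is replaced by its chord, an upper bound by convexity,
    -- so `q` is never differentiated.
    have d3 : HasDerivAt (fun t : ℝ => t * (P.q z - P.q x₀)) (P.q z - P.q x₀) 0 := by
      simpa using (hasDerivAt_id (0 : ℝ)).mul_const (P.q z - P.q x₀)
    have d4 := ((d1.sub_const (A.ft 0 x₀)).fun_add d2).fun_add d3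
    have h1 : ∀ᶠ t in 𝓝[>] (0 : ℝ), t < 1 := nhdsWithin_le_nhds (Iio_mem_nhds one_pos)
    have h2 := deriv_nonneg_of_eventually_nonneg d4 (by simp [e0]) (by
      filter_upwards [eventually_smul_mem_openBox hβ (z - x₀), h1, self_mem_nhdsWithin]
        with t ht ht1 ht0
      have ht0' : (0 : ℝ) < t := ht0
      have h3 := hlim _ ht (hR.standing.K_convex.add_smul_sub_mem hx₀ hz ⟨ht0'.le, ht1.le⟩)
      have h4 := hR.standing.q_convex.2 (hR.standing.K_sub_D hx₀) (hR.standing.K_sub_D hz)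
        (by linarith : 0 ≤ 1 - t) ht0'.le (by ring)
      have e : (1 - t) • x₀ + t • z = x₀ + t • (z - x₀) := by
        rw [sub_smul, one_smul, smul_sub]; abel
      rw [e] at h4
      simp only [smul_eq_mul] at h4
      simp only [obj, add_zero] at h3
      linarith)
    rw [ha, inner_add_left]
    linarith
  obtain ⟨v, hv, ζ, hζ, hsum⟩ := exists_subgradient_of_isMinOn hR.standing.K_convex
    hR.standing.K_sub_D hR.standing.q_convex hR.standing.q_lipschitz hx₀ hmin
  refine ⟨(WithLp.toLp 2 ξ₀, WithLp.toLp 2 π₀), ?_, ?_, v, hv, ζ, hζ, ?_⟩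
  · exact mem_normalCone_nonposOrthant hg hξ₀ fun i => by simpa [hφ] using e1 i
  · have : (WithLp.toLp 2 fun j => P.h j x₀ : Vec p) = 0 := by
      ext j; simpa using hh j
    rw [this]
    refine ⟨rfl, fun y hy => ?_⟩
    rw [Set.mem_singleton_iff.1 hy]
    simp
  · rw [← hsum, ha]
    abel

theorem isKKT_of_tendsto (hR : A.Regular P c) {x₀ : Vec n} (h : P.EMFCQ x₀)
    {x : ℕ → Vec n} (hx : Tendsto x atTop (𝓝 x₀)) (hxK : ∀ k, x k ∈ P.K)
    (hd : Tendsto (fun k => A.dir P (x k)) atTop (𝓝 0)) : P.IsKKT x₀ := by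
  obtain ⟨M, hM⟩ := hR.exists_eventually_hasMultipliers h
  obtain ⟨N, hN⟩ := eventually_atTop.1 ((tendsto_nhdsWithin_iff.2
    ⟨hx, Eventually.of_forall hxK⟩).eventually hM)
  have hsh := tendsto_add_atTop_nat N
  exact hR.isKKT_of_tendsto_of_multipliers h (hx.comp hsh) (fun k => hxK _) (hd.comp hsh)
    fun k => hN (k + N) (Nat.le_add_left _ _)

/-- Compare `d(x)` with the null step in the multiplier inequality, and use strong convexity of `f̃`
to pass to the linearization of `f`. The increase allowed by the last term is what the penalty will
pay for. -/
theorem directional_decrease (hR : A.Regular P c) {x : Vec n} (hx : x ∈ P.K) {M : ℝ}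
    (hM : A.HasMultipliers P M x) :
    ⟪gradient P.f x, A.dir P x⟫ + (P.q (x + A.dir P x) - P.q x) ≤
      -(c / 2 * ‖A.dir P x‖ ^ 2) + M * (P.infeas x - A.kappa P x) := by
  obtain ⟨ξ, π, hξ, hle, hL⟩ := hM
  have h1 := hL 0 (zero_mem_boxBall hR.admissible.β_pos.le) (by simpa using hx)
  have h2 := A.lagr_le P (A.kappa P x) π hξ 0 x
  rw [hR.viol_zero hx] at h2
  have h3 := mul_le_mul_of_nonneg_left hle (sub_nonneg.2 (hR.kappa_le_infeas hx))
  have h4 := StrongConvexOn.add_inner_le (hR.ft_strongConvex x hx)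
    (zero_mem_boxBall hR.admissible.β_pos.le) (hR.dir_mem_boxBall hx) (hR.ft_gradient x hx)
  simp only [sub_zero] at h4
  simp only [obj, add_zero] at h1
  linarith

/-- The exact penalty function that serves as a merit function. -/
def _root_.DSM.Problem.merit (P : Problem n m p) (M : ℝ) (x : Vec n) : ℝ :=
  P.f x + P.q x + M * P.infeas x

/-- Up to an error `L t² ‖d‖²`, the violation after the step is at most `(1 - t) φ + t κ`, by
convexity of `g̃` and linearity of `h̃`. Weighted by `M`, this gain cancels the term `M (φ - κ)` of
`directional_decrease`. -/
theorem exists_merit_decrease (hR : A.Regular P c) {T : Set (Vec n)} (hT : IsCompact T)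
    (hTc : Convex ℝ T) (hTK : T ⊆ P.K) :
    ∃ L : ℝ, ∀ M, 0 ≤ M → ∀ x ∈ T, A.HasMultipliers P M x → ∀ t : ℝ, 0 ≤ t → t ≤ 1 →
      x + t • A.dir P x ∈ T →
      P.merit M (x + t • A.dir P x) ≤ P.merit M x - t * (c / 2 * ‖A.dir P x‖ ^ 2) +
        (1 + M) * L * t ^ 2 * ‖A.dir P x‖ ^ 2 := by
  obtain ⟨Lf, hLf0, hLf⟩ := hR.standing.f_smooth.exists_quadratic_bound hTK hT hTc
  choose Lg hLg0 hLg using fun i => (hR.standing.g_smooth i).exists_quadratic_bound hTK hT hTc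
  choose Lh hLh0 hLh using fun j => (hR.standing.h_smooth j).exists_quadratic_bound hTK hT hTc
  have sg : 0 ≤ ∑ i, Lg i := Finset.sum_nonneg fun i _ => hLg0 i
  have sh : 0 ≤ ∑ j, Lh j := Finset.sum_nonneg fun j _ => hLh0 j
  -- The sum dominates each individual constant, so one `L` serves the objective and all the
  -- constraints.
  refine ⟨Lf + (∑ i, Lg i + ∑ j, Lh j), fun M hM x hx hmult t ht0 ht1 hxt => ?_⟩
  set L := Lf + (∑ i, Lg i + ∑ j, Lh j) with hL
  have hL0 : 0 ≤ L := by positivity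
  have hxK := hTK hx
  set d := A.dir P x with hd
  have hnorm : ‖t • d‖ ^ 2 = t ^ 2 * ‖d‖ ^ 2 := by rw [norm_smul, mul_pow, Real.norm_eq_abs, sq_abs]
  set e := t ^ 2 * ‖d‖ ^ 2 with he
  have he0 : 0 ≤ e := by positivity
  have hf := (abs_le.1 (hLf x hx _ hxt)).2
  rw [hnorm, real_inner_smul_right] at hf
  have hq : P.q (x + t • d) ≤ (1 - t) * P.q x + t * P.q (x + d) := by
    have := hR.standing.q_convex.2 (hR.standing.K_sub_D hxK)
      (hR.standing.K_sub_D (hR.add_dir_mem hxK)) (by linarith : 0 ≤ 1 - t) ht0 (by ring)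
    have e : (1 - t) • x + t • (x + d) = x + t • d := by
      rw [sub_smul, one_smul, smul_add]; abel
    rw [e] at this
    simpa only [smul_eq_mul] using this
  have hviol := hR.viol_dir_le hxK
  have hκ0 := hR.kappa_nonneg hxK
  have hφ0 : 0 ≤ P.infeas x := maxViolation_nonneg _ _
  have ht1' : 0 ≤ 1 - t := by linarith
  have hφ : P.infeas (x + t • d) ≤ (1 - t) * P.infeas x + t * A.kappa P x + L * e := by
    refine maxViolation_le_iff.2 ⟨by positivity, fun i => ?_, fun j => ?_⟩
    · have h1 := (abs_le.1 (hLg i x hx _ hxt)).2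
      rw [hnorm, real_inner_smul_right] at h1
      have h2 := ConvexOn.add_inner_le (hR.gt_convex i x hxK)
        (zero_mem_boxBall hR.admissible.β_pos.le) (hR.dir_mem_boxBall hxK) (hR.gt_gradient i x hxK)
      rw [hR.gt_zero i x hxK, sub_zero] at h2
      have h3 : ⟪gradient (P.g i) x, d⟫ ≤ A.kappa P x - P.g i x := by
        linarith [A.gt_le_viol P d x i]
      have h4 := mul_le_mul_of_nonneg_left h3 ht0
      have h5 := mul_le_mul_of_nonneg_left (g_le_infeas P x i) ht1'
      have h6 : Lg i ≤ L := by
        have := Finset.single_le_sum (fun i _ => hLg0 i) (Finset.mem_univ i)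
        linarith
      have h7 := mul_le_mul_of_nonneg_right h6 he0
      linarith
    · have h1 := hLh j x hx _ hxt
      rw [hnorm, real_inner_smul_right] at h1
      have h2 : |P.h j x + ⟪gradient (P.h j) x, d⟫| ≤ A.kappa P x :=
        (A.abs_ht_le_viol P d x j).trans hviol
      have h6 : Lh j ≤ L := by
        have := Finset.single_le_sum (fun j _ => hLh0 j) (Finset.mem_univ j)
        linarith
      have h7 := mul_le_mul_of_nonneg_right h6 he0
      obtain ⟨a1, a2⟩ := abs_le.1 h1
      obtain ⟨b1, b2⟩ := abs_le.1 h2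
      obtain ⟨c1, c2⟩ := abs_le.1 (abs_h_le_infeas P x j)
      have m1 := mul_le_mul_of_nonneg_left b1 ht0
      have m2 := mul_le_mul_of_nonneg_left b2 ht0
      have m3 := mul_le_mul_of_nonneg_left c1 ht1'
      have m4 := mul_le_mul_of_nonneg_left c2 ht1'
      exact abs_le.2 ⟨by linarith, by linarith⟩
  have hdd := mul_le_mul_of_nonneg_left (hR.directional_decrease hxK hmult) ht0
  have hφM := mul_le_mul_of_nonneg_left hφ hM
  have hLfe : Lf * e ≤ L * e := mul_le_mul_of_nonneg_right (by linarith) he0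
  have hgoal : (1 + M) * L * t ^ 2 * ‖d‖ ^ 2 = L * e + M * (L * e) := by rw [he]; ring
  rw [hgoal]
  simp only [Problem.merit]
  linarith

theorem iterates_mem (hR : A.Regular P c) {γ : ℕ → ℝ} (hγ : IsStepsize γ) {x : ℕ → Vec n}
    (hx : A.IsRun P γ x) (ν : ℕ) : x ν ∈ P.K := by
  induction ν with
  | zero => exact hx.start
  | succ ν ih =>
    by_cases h : P.IsGenStationary (x ν)
    · rwa [hx.halt ν h]
    · rw [hx.step ν h]
      have := hR.standing.K_convex.add_smul_sub_mem ih (hR.add_dir_mem ih)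
        ⟨(hγ.pos ν).le, hγ.le_one ν⟩
      simpa using this

/-- A sequence in a compact part of `K` whose cluster points all satisfy the eMFCQ has eventually
bounded multipliers. -/
theorem exists_eventually_hasMultipliers_seq (hR : A.Regular P c) {T : Set (Vec n)}
    (hT : IsCompact T) (hTK : T ⊆ P.K) {x : ℕ → Vec n} (hx : ∀ ν, x ν ∈ T)
    (hcl : ∀ y, MapClusterPt y atTop x → P.EMFCQ y) :
    ∃ M, 0 ≤ M ∧ ∀ᶠ ν in atTop, A.HasMultipliers P M (x ν) := by
  by_contra hcon
  push Not at hcon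
  have h1 : ∀ k : ℕ, ∃ ν, k ≤ ν ∧ ¬ A.HasMultipliers P k (x ν) := fun k =>
    frequently_atTop.1 (hcon k k.cast_nonneg) k
  choose s hs hsM using h1
  obtain ⟨y, -, ψ, hψ, hlim⟩ := hT.tendsto_subseq fun k => hx (s k)
  have hst : Tendsto (fun k => s (ψ k)) atTop atTop :=
    (tendsto_atTop_mono hs tendsto_id).comp hψ.tendsto_atTop
  have hy : P.EMFCQ y := hcl y (MapClusterPt.of_comp hst hlim.mapClusterPt)
  obtain ⟨M, hM⟩ := hR.exists_eventually_hasMultipliers hy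
  have hev := (tendsto_nhdsWithin_iff.2 ⟨hlim, Eventually.of_forall fun k => hTK (hx _)⟩).eventually
    hM
  obtain ⟨k, hk1, hk2⟩ := (hev.and (hψ.tendsto_atTop.eventually
    (eventually_ge_atTop ⌈M⌉₊))).exists
  exact hsM (ψ k) (hk1.mono ((Nat.le_ceil M).trans (by exact_mod_cast hk2)))

/-- The merit function is bounded below on `T`; once `(1 + M) L γ < c / 4`, the quadratic error
consumes at most half of the decrease `γ c / 2 ‖d‖²`. -/
theorem summable_dir_sq (hR : A.Regular P c) {γ : ℕ → ℝ} (hγ : IsStepsize γ) {T : Set (Vec n)}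
    (hT : IsCompact T) (hTc : Convex ℝ T) (hTK : T ⊆ P.K) {x : ℕ → Vec n} (hx : ∀ ν, x ν ∈ T)
    (hstep : ∀ ν, x (ν + 1) = x ν + γ ν • A.dir P (x ν))
    (hcl : ∀ y, MapClusterPt y atTop x → P.EMFCQ y) :
    Summable fun ν => γ ν * ‖A.dir P (x ν)‖ ^ 2 := by
  obtain ⟨M, hM0, hM⟩ := hR.exists_eventually_hasMultipliers_seq hT hTK hx hcl
  obtain ⟨L, hL⟩ := hR.exists_merit_decrease hT hTc hTK
  have hcont : ContinuousOn (P.merit M) T :=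
    ((hR.standing.f_smooth.continuousOn.add hR.q_continuousOn).add
      (hR.infeas_continuousOn.const_smul M)).mono hTK
  obtain ⟨Q, hQ⟩ := hT.exists_bound_of_continuousOn hcont
  have hc := hR.modulus_pos
  refine summable_of_eventually_decrease (w := fun ν => P.merit M (x ν)) (ℓ := -Q) (C := c / 4)
    (by positivity) (fun ν => mul_nonneg (hγ.pos ν).le (sq_nonneg _))
    (fun ν => (abs_le.1 (hQ _ (hx ν))).1) ?_
  have hsmall : Tendsto (fun ν => (1 + M) * L * γ ν) atTop (𝓝 0) := by
    simpa using hγ.tendsto_zero.const_mul ((1 + M) * L)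
  filter_upwards [hM, hsmall.eventually (Iio_mem_nhds (by positivity : (0 : ℝ) < c / 4))]
    with ν hν hsν
  have hsν' : (1 + M) * L * γ ν < c / 4 := hsν
  have h1 := hL M hM0 (x ν) (hx ν) hν (γ ν) (hγ.pos ν).le (hγ.le_one ν) (hstep ν ▸ hx (ν + 1))
  rw [hstep ν]
  have h2 := mul_le_mul_of_nonneg_right hsν'.le
    (mul_nonneg (hγ.pos ν).le (sq_nonneg ‖A.dir P (x ν)‖))
  have h3 : (1 + M) * L * γ ν ^ 2 * ‖A.dir P (x ν)‖ ^ 2 =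
      (1 + M) * L * γ ν * (γ ν * ‖A.dir P (x ν)‖ ^ 2) := by ring
  rw [h3] at h1
  linarith

end Regular

end Method

end DSM

end

/-! ### The convergence theorem -/

theorem theorem1 {n m p : ℕ} (P : DSM.Problem n m p) (hP : P.Standing)
    (A : DSM.Method n m) (hA : A.Admissible) (hAssA : A.AssumptionA P)
    (γ : ℕ → ℝ) (hγ : DSM.Method.IsStepsize γ)
    (x : ℕ → DSM.Vec n) (hx : A.IsRun P γ x) :
    (∀ ν, x ν ∈ P.K) ∧
    (¬ Bornology.IsBounded (Set.range x) ∨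
      ((∃ xhat, MapClusterPt xhat atTop x ∧ P.IsGenStationary xhat ∧
          (P.EMFCQ xhat → P.IsKKT xhat)) ∧
        ((∀ y, MapClusterPt y atTop x → P.EMFCQ y) → A.AssumptionB P →
          ∀ y, MapClusterPt y atTop x → P.IsKKT y))) := by
  obtain ⟨c, hR⟩ := DSM.Method.AssumptionA.exists_regular hP hA hAssA
  have hxK := hR.iterates_mem hγ hx
  refine ⟨hxK, ?_⟩
  by_cases hbdd : Bornology.IsBounded (Set.range x)
  swap
  · exact Or.inl hbdd
  refine Or.inr ?_
  by_cases hhalt : ∃ ν, P.IsGenStationary (x ν)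
  · obtain ⟨N, hN⟩ := hhalt
    have hconst : ∀ k, x (N + k) = x N := fun k => by
      induction k with
      | zero => rfl
      | succ k ih => rw [← add_assoc, hx.halt (N + k) (ih ▸ hN), ih]
    have hlim : Tendsto x atTop (𝓝 (x N)) := by
      refine tendsto_const_nhds.congr' ?_
      filter_upwards [eventually_ge_atTop N] with ν hν
      obtain ⟨k, rfl⟩ := Nat.exists_eq_add_of_le hν
      exact (hconst k).symm
    refine ⟨⟨x N, hlim.mapClusterPt, hN, hN.isKKT⟩, fun hcl _ y hy => ?_⟩
    obtain ⟨ψ, hψ, hψlim⟩ := MapClusterPt.tendsto_subseq hy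
    have : y = x N := tendsto_nhds_unique hψlim (hlim.comp hψ.tendsto_atTop)
    subst this
    exact hN.isKKT (hcl _ hy)
  push Not at hhalt
  obtain ⟨R, hRad⟩ := hbdd.subset_closedBall 0
  -- Compactness gives uniform Lipschitz constants, and convexity keeps the segments between
  -- iterates inside `T`.
  set T := P.K ∩ Metric.closedBall 0 R with hTdef
  have hT : IsCompact T := (isCompact_closedBall 0 R).inter_left hP.K_closed
  have hTc : Convex ℝ T := hP.K_convex.inter (convex_closedBall 0 R)
  have hTK : T ⊆ P.K := Set.inter_subset_left
  have hxT : ∀ ν, x ν ∈ T := fun ν => ⟨hxK ν, hRad ⟨ν, rfl⟩⟩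
  by_cases hcl : ∀ y, MapClusterPt y atTop x → P.EMFCQ y
  swap
  -- A limit point violating the eMFCQ is itself generalized stationary, which settles (i) and makes
  -- (ii) vacuous.
  · refine ⟨?_, fun h => absurd h hcl⟩
    push Not at hcl
    obtain ⟨y, hy, hyE⟩ := hcl
    have hyK : y ∈ P.K := by
      obtain ⟨ψ, -, hψlim⟩ := MapClusterPt.tendsto_subseq hy
      exact hP.K_closed.mem_of_tendsto hψlim (Eventually.of_forall fun k => hxK _)
    exact ⟨y, hy, DSM.Problem.isGenStationary_of_not_EMFCQ hyK hyE, fun h => absurd h hyE⟩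
  have hstep : ∀ ν, x (ν + 1) = x ν + γ ν • A.dir P (x ν) := fun ν => hx.step ν (hhalt ν)
  have hsum := hR.summable_dir_sq hγ hT hTc hTK hxT hstep hcl
  refine ⟨?_, fun _ hB y hy => ?_⟩
  · have h1 : ∀ k : ℕ, ∃ ν, k ≤ ν ∧ ‖A.dir P (x ν)‖ < 1 / ((k : ℝ) + 1) := fun k =>
      frequently_atTop.1 (DSM.frequently_lt_of_summable hγ hsum Nat.one_div_pos_of_nat) k
    choose s hs hsd using h1
    obtain ⟨y, -, ψ, hψ, hlim⟩ := hT.tendsto_subseq fun k => hxT (s k)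
    have hst : Tendsto (fun k => s (ψ k)) atTop atTop :=
      (tendsto_atTop_mono hs tendsto_id).comp hψ.tendsto_atTop
    have hy : MapClusterPt y atTop x := MapClusterPt.of_comp hst hlim.mapClusterPt
    have hd : Tendsto (fun k => A.dir P (x (s k))) atTop (𝓝 0) :=
      squeeze_zero_norm (fun k => (hsd k).le) tendsto_one_div_add_atTop_nhds_zero_nat
    have hKKT := hR.isKKT_of_tendsto (hcl y hy) hlim (fun k => hxK _)
      (hd.comp hψ.tendsto_atTop)
    exact ⟨y, hy, Or.inl hKKT, fun _ => hKKT⟩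
  · obtain ⟨μ, α, hμ, hα, hHol⟩ := hB T hT hTK
    have hd0 : Tendsto (fun ν => ‖A.dir P (x ν)‖) atTop (𝓝 0) := by
      refine DSM.tendsto_zero_of_summable (x := x) hγ (fun _ => norm_nonneg _) hsum
        (fun ν => ?_) fun δ hδ => ?_
      · rw [hstep ν, dist_self_add_right, norm_smul, Real.norm_of_nonneg (hγ.pos ν).le]
      -- The radius solves `μ η ^ α = δ`.
      · refine ⟨(δ / μ) ^ α⁻¹, Real.rpow_pos_of_pos (div_pos hδ hμ) _, fun i j hij => ?_⟩
        rw [dist_eq_norm] at hij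
        have h1 := Real.rpow_lt_rpow (norm_nonneg _) hij hα
        rw [Real.rpow_inv_rpow (div_pos hδ hμ).le hα.ne', lt_div_iff₀ hμ] at h1
        calc _ ≤ ‖A.dir P (x i) - A.dir P (x j)‖ := abs_norm_sub_norm_le _ _
          _ ≤ μ * ‖x i - x j‖ ^ α := hHol _ (hxT i) _ (hxT j)
          _ < δ := by linarith
    obtain ⟨ψ, hψ, hψlim⟩ := MapClusterPt.tendsto_subseq hy
    exact hR.isKKT_of_tendsto (hcl y hy) hψlim (fun k => hxK _)
      ((tendsto_zero_iff_norm_tendsto_zero.2 hd0).comp hψ.tendsto_atTop)
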